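/- **Conventions.** A residuated lattice is an algebra $\langle A,\wedge,\vee,\cdot,\backslash,/,e\rangle$ such that $\langle A,\wedge,\vee\rangle$ is a lattice, $\langle A,\cdot,e\rangle$ is a monoid and $b\le a\backslash c \iff a\cdot b\le c \iff a\le c/b$. An FL-algebra is a residuated lattice with an additional, arbitrary constant $0$; residuated lattices are regarded as the FL-algebras satisfying $e\approx 0$. A variety is an equationally defined class of algebras. A canonical extension of a lattice $A$ is a complete lattice $A^\sigma$ with an order embedding $A\to A^\sigma$ preserving existing finite meets and joins (including empty ones, when they exist) such that, with closed (open) elements being the meets (joins) in $A^\sigma$ of nonempty subsets of $A$, (dense) every element of $A^\sigma$ is both a join of closed elements and a meet of open elements, and (compact) whenever $S$ is a nonempty set of closed elements and $T$ a nonempty set of open elements with $\bigwedge S\le\bigvee T$, there are finite $S_0\subseteq S$, $T_0\subseteq T$ with $\bigwedge S_0\le\bigvee T_0$. The canonical extension of an FL-algebra $A$ is $\langle A^\sigma,\wedge,\vee,\cdot^\sigma,\backslash^\pi,/^\pi,e,0\rangle$, where for $f\colon A^2\to A$ and $x\in (A^\sigma)^2$ (order coordinatewise) $$f^\sigma(x)=\bigvee\Bigl\{\bigwedge\{f(a):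 a\in A^2,\ p\le a\le q\}: p \text{ closed},\ q\text{ open},\ p\le x\le q\Bigr\},$$ $$f^\pi(x)=\bigwedge\Bigl\{\bigvee\{f(a): a\in A^2,\ p\le a\le q\}: p \text{ closed},\ q\text{ open},\ p\le x\le q\Bigr\},$$ with $p,q$ ranging over pairs of closed, respectively open, elements. A class $\mathcal C$ of FL-algebras is closed under canonical extensions if the canonical extension of each member of $\mathcal C$ is isomorphic to a member of $\mathcal C$. $\mathbb{ISP}(\mathcal C)$ is the class of all algebras that embed into a direct product of members of $\mathcal C$. For a variety $\mathcal V$, write $\Sigma\models_{\mathcal V}\varepsilon$ if every assignment in a member of $\mathcal V$ that satisfies all equations in $\Sigma$ satisfies $\varepsilon$. $\mathcal V$ is *coherent* if every finitely generated subalgebra of a finitely presented member of $\mathcal V$ is finitely presented (in $\mathcal V$). $\mathcal V$ admits *(right) uniform deductive interpolation* if for all disjoint finite sets of variables $\bar x,\bar y$ and every finite set of equations $\Sigma(\bar x,\bar y)$ there is a finite set of equations $\Pi(\bar y)$ such that for every equation $\varepsilon(\bar y,\bar z)$, with $\bar z$ disjoint from $\bar x,\bar y$: $\Sigma\models_{\mathcal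 V}\varepsilon \iff \Pi\models_{\mathcal V}\varepsilon$. A theory $T^*$ is a *model completion* of a theory $T$ if every model of either theory embeds into a model of the other, every embedding between models of $T^*$ is elementary, and for every model $M$ of $T$ the theory $T^*\cup\mathrm{Diag}(M)$ is complete, where $\mathrm{Diag}(M)$ is the quantifier-free diagram of $M$. **Corollary 5.11.** (a) Let $\mathcal V=\mathbb{ISP}(\mathcal C)$ be a variety of FL-algebras (in particular, of residuated lattices) such that $\mathcal C$ is closed under canonical extensions and, for every $n\in\mathbb N$, $\mathcal V\not\models (e\wedge x)^{n+1}\approx(e\wedge x)^n$. Then $\mathcal V$ is not coherent, $\mathcal V$ does not admit uniform deductive interpolation, and the first-order theory of $\mathcal V$ does not have a model completion. (b) The same three conclusions hold for each of the following varieties: $\mathbf{FL}$, all FL-algebras; $\mathbf{FL}_e$, those satisfying $xy\approx yx$; $\mathbf{FL}_w$, those satisfying $x\le e$ and $0\le x$; $\mathbf{FL}_{ew}$, those satisfying all three; and the four varieties obtained from these by adding the identities $0/(x\backslash 0)\approx x\approx(0/x)\backslash 0$, the involutive version of $\mathbf{FL}_e$ being $\mathbf{MALL}$. -/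

import Mathlib

open FirstOrder FirstOrder.Language CategoryTheory

universe u

namespace UnifInterp

/-! ## Universal algebra over a first-order language

A class of algebras is a set of (bundled) `L`-structures. It is used for algebraic languages `L`
(no relation symbols). -/

section UniversalAlgebra

variable (L : FirstOrder.Language.{0, 0})

/-- An equation `s ≈ t` with variables in `α`. -/
abbrev Eqn (α : Type) : Type := L.Term α × L.Term α

variable {L}

/-- The equation `ε` holds in `A` under the assignment `v`. -/
def Eqn.Holds {α : Type} (ε : Eqn L α) {A : Type u} [L.Structure A] (v : α → A) : Prop :=
  ε.1.realize v = ε.2.realize v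

/-- Renaming of variables in an equation. -/
def Eqn.relabel {α β : Type} (ε : Eqn L α) (g : α → β) : Eqn L β :=
  (ε.1.relabel g, ε.2.relabel g)

/-- `V ⊨ ε`: the equation holds in all members of `V` under all assignments. -/
def Satisfies (V : Set (Bundled.{u} L.Structure)) {α : Type} (ε : Eqn L α) : Prop :=
  ∀ A ∈ V, ∀ v : α → A, ε.Holds v

/-- Equational consequence `Σ ⊨_V ε`. -/
def Entails (V : Set (Bundled.{u} L.Structure)) {α : Type} (E : Set (Eqn L α)) (ε : Eqn L α) :
    Prop :=
  ∀ A ∈ V, ∀ v : α → A, (∀ δ ∈ E, δ.Holds v) → ε.Holds v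

/-- A variety is a class of algebras that is defined by a set of equations. -/
def IsVariety (V : Set (Bundled.{u} L.Structure)) : Prop :=
  ∃ E : Set (Eqn L ℕ), ∀ A : Bundled.{u} L.Structure,
    A ∈ V ↔ ∀ ε ∈ E, ∀ v : ℕ → A, ε.Holds v

/-- The direct product of a family of structures. -/
instance piStructure {I : Type u} (B : I → Type u) [∀ i, L.Structure (B i)] :
    L.Structure (∀ i, B i) where
  funMap f x := fun i => Structure.funMap f (fun k => x k i)
  RelMap r x := ∀ i, Structure.RelMap r (fun k => x k i)

/-- `ISP(C)`: the isomorphic copies of subalgebras of direct products of members of `C`, that is,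
the algebras that embed into such a product. -/
def ISP (C : Set (Bundled.{u} L.Structure)) : Set (Bundled.{u} L.Structure) :=
  {A | ∃ (I : Type u) (B : I → Bundled.{u} L.Structure),
    (∀ i, B i ∈ C) ∧ Nonempty (A ↪[L] (∀ i, B i))}

/-- `A` is a finitely presented member of `V`: it belongs to `V` and has a presentation in `V` by
finitely many generators `g` and a finite set `R` of relations. That is, the `g i` generate `A` and
satisfy `R`, and every tuple that satisfies `R` in a member of `V` is the image of `g` under a
homomorphism (equivalently, `A` is isomorphic to the quotient of the free algebra of `V` on the
generators by the congruence generated by `R`). -/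
def FinitelyPresented (V : Set (Bundled.{u} L.Structure)) (A : Bundled.{u} L.Structure) : Prop :=
  A ∈ V ∧ ∃ (n : ℕ) (R : Set (Eqn L (Fin n))) (g : Fin n → A), R.Finite ∧
    Substructure.closure L (Set.range g) = ⊤ ∧ (∀ ε ∈ R, ε.Holds g) ∧
    ∀ B ∈ V, ∀ h : Fin n → B, (∀ ε ∈ R, ε.Holds h) → ∃ f : A →[L] B, ∀ i, f (g i) = h i

/-- `V` is coherent: every finitely generated subalgebra of a finitely presented member of `V` is
finitely presented. -/
def Coherent (V : Set (Bundled.{u} L.Structure)) : Prop :=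
  ∀ B : Bundled.{u} L.Structure, FinitelyPresented V B →
    ∀ S : L.Substructure B, S.FG → FinitelyPresented V (Bundled.of S)

/-- `V` admits (right) uniform deductive interpolation: for any finite sets of variables
`x = Fin m`, `y = Fin n` and any finite set `E` of equations in `x, y`, there is a finite set `P` of
equations in `y` such that, for every equation `ε` in `y` and further variables `z = Fin k`,
`E ⊨_V ε` if and only if `P ⊨_V ε`. -/
def UniformDeductiveInterpolation (V : Set (Bundled.{u} L.Structure)) : Prop :=
  ∀ (m n : ℕ) (E : Set (Eqn L (Fin m ⊕ Fin n))), E.Finite →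
    ∃ P : Set (Eqn L (Fin n)), P.Finite ∧ ∀ (k : ℕ) (ε : Eqn L (Fin n ⊕ Fin k)),
      Entails V ((fun δ : Eqn L (Fin m ⊕ Fin n) =>
          (δ.relabel (Sum.map id Sum.inl) : Eqn L (Fin m ⊕ (Fin n ⊕ Fin k)))) '' E)
        (ε.relabel Sum.inr) ↔
      Entails V ((fun δ : Eqn L (Fin n) => (δ.relabel Sum.inl : Eqn L (Fin n ⊕ Fin k))) '' P) ε

/-- The first-order theory of a class of structures. -/
def theoryOf (V : Set (Bundled.{u} L.Structure)) : L.Theory :=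
  {φ | ∀ A ∈ V, A ⊨ φ}

variable (L) in
/-- The (quantifier-free) diagram of `M`: the atomic sentences and negations of atomic sentences
with parameters from `M` that are true in `M`. -/
def diagram (M : Type u) [L.Structure M] : L[[M]].Theory :=
  {φ | (BoundedFormula.IsAtomic φ ∨ ∃ ψ : L[[M]].Sentence, BoundedFormula.IsAtomic ψ ∧ φ = ψ.not) ∧
    M ⊨ φ}

/-- `T'` is a model companion of `T`: every model of one theory embeds into a model of the other,
and every embedding between models of `T'` is elementary. -/
def IsModelCompanion (T' T : L.Theory) : Prop :=
  (∀ M : T.ModelType.{0, 0, u}, ∃ N : T'.ModelType.{0, 0, u}, Nonempty (M ↪[L] N)) ∧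
  (∀ N : T'.ModelType.{0, 0, u}, ∃ M : T.ModelType.{0, 0, u}, Nonempty (N ↪[L] M)) ∧
  ∀ (M N : T'.ModelType.{0, 0, u}) (f : M ↪[L] N) (n : ℕ) (φ : L.Formula (Fin n)) (x : Fin n → M),
    φ.Realize (f ∘ x) ↔ φ.Realize x

/-- `T'` is a model completion of `T`: it is a model companion of `T`, and together with the diagram
of any model of `T` it is a complete theory. -/
def IsModelCompletion (T' T : L.Theory) : Prop :=
  IsModelCompanion.{u} T' T ∧
  ∀ M : T.ModelType.{0, 0, u},
    ((L.lhomWithConstants M).onTheory T' ∪ diagram L M).IsComplete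

/-- `T` has a model completion. -/
def HasModelCompletion (T : L.Theory) : Prop :=
  ∃ T' : L.Theory, IsModelCompletion.{u} T' T

end UniversalAlgebra

/-! ## FL-algebras -/

/-- An FL-algebra: a residuated lattice `⟨A, ∧, ∨, ·, \, /, e⟩` with one more constant `0`, written
`falsum`, which is arbitrary. The unit `e` is `1`; `ldiv a c` is `a \ c` and `rdiv c b` is `c / b`.
Residuated lattices are identified with the FL-algebras with `e = 0`. -/
class FLAlgebra (A : Type u) extends Lattice A, Monoid A where
  ldiv : A → A → A
  rdiv : A → A → A
  falsum : A
  le_ldiv_iff : ∀ a b c : A, b ≤ ldiv a c ↔ a * b ≤ c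
  le_rdiv_iff : ∀ a b c : A, a ≤ rdiv c b ↔ a * b ≤ c

/-- The operation symbols of FL-algebras. -/
inductive FLFunc : ℕ → Type
  | meet : FLFunc 2
  | join : FLFunc 2
  | mul : FLFunc 2
  | ldiv : FLFunc 2
  | rdiv : FLFunc 2
  | one : FLFunc 0
  | falsum : FLFunc 0

/-- The signature of FL-algebras. -/
def flLang : FirstOrder.Language.{0, 0} := ⟨FLFunc, fun _ => Empty⟩

/-- The `flLang`-structure given by a choice of the operations. -/
abbrev mkStructure {A : Type u} (meet join mul ldiv rdiv : A → A → A) (one falsum : A) :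
    flLang.Structure A where
  funMap
    | FLFunc.meet, v => meet (v 0) (v 1)
    | FLFunc.join, v => join (v 0) (v 1)
    | FLFunc.mul, v => mul (v 0) (v 1)
    | FLFunc.ldiv, v => ldiv (v 0) (v 1)
    | FLFunc.rdiv, v => rdiv (v 0) (v 1)
    | FLFunc.one, _ => one
    | FLFunc.falsum, _ => falsum
  RelMap r _ := r.elim

/-- An FL-algebra as an algebra in the signature `flLang`. -/
def toAlg (A : Bundled.{u} FLAlgebra) : Bundled.{u} flLang.Structure :=
  letI := A.str
  ⟨A.α, mkStructure (fun a b => a ⊓ b) (fun a b => a ⊔ b) (fun a b => a * b)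
    FLAlgebra.ldiv FLAlgebra.rdiv 1 FLAlgebra.falsum⟩

/-! ## Canonical extensions -/

section Canonical

variable {P D : Type u} [PartialOrder P] [CompleteLattice D]

/-- A completion of a poset: an order embedding into a complete lattice that preserves all existing
finite meets and joins (including the empty ones). -/
structure IsCompletion (j : P → D) : Prop where
  le_iff : ∀ a b, j a ≤ j b ↔ a ≤ b
  map_isGLB : ∀ (S : Set P) (a : P), S.Finite → IsGLB S a → IsGLB (j '' S) (j a)
  map_isLUB : ∀ (S : Set P) (a : P), S.Finite → IsLUB S a → IsLUB (j '' S) (j a)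

/-- Closed elements: meets of (nonempty) sets of elements of `P`. -/
def IsClosedElt (j : P → D) (c : D) : Prop :=
  ∃ X : Set P, X.Nonempty ∧ c = sInf (j '' X)

/-- Open elements: joins of (nonempty) sets of elements of `P`. -/
def IsOpenElt (j : P → D) (c : D) : Prop :=
  ∃ X : Set P, X.Nonempty ∧ c = sSup (j '' X)

/-- A canonical extension of a poset is a dense and compact completion. The sets in the definitions
of closed and open elements and of compactness are nonempty, as usual for posets that need not be
bounded; if `P` has a least and a greatest element, then this restriction is immaterial. -/
structure IsCanonicalExtension (j : P → D) : Prop extends IsCompletion j where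
  dense_closed : ∀ c : D, ∃ S : Set D, (∀ k ∈ S, IsClosedElt j k) ∧ c = sSup S
  dense_open : ∀ c : D, ∃ S : Set D, (∀ o ∈ S, IsOpenElt j o) ∧ c = sInf S
  compact : ∀ S T : Set D, S.Nonempty → T.Nonempty →
    (∀ k ∈ S, IsClosedElt j k) → (∀ o ∈ T, IsOpenElt j o) →
    sInf S ≤ sSup T → ∃ S₀ ⊆ S, ∃ T₀ ⊆ T, S₀.Finite ∧ T₀.Finite ∧ sInf S₀ ≤ sSup T₀

/-- `[p, q] ∩ P` for a closed element `p` and an open element `q` with `p ≤ x ≤ q`: the sets of this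
form, over all such `p` and `q`. -/
def nbhds (j : P → D) (x : D) : Set (Set P) :=
  {N | ∃ p q : D, IsClosedElt j p ∧ IsOpenElt j q ∧ p ≤ x ∧ x ≤ q ∧ N = {a | p ≤ j a ∧ j a ≤ q}}

/-- The `σ`-extension of a binary operation (extensions are computed in `P × P`, coordinatewise):
`f^σ(x) = ⋁ { ⋀ { f(a) | a ∈ P², p ≤ a ≤ q } | p closed, q open, p ≤ x ≤ q }`. The intervals, hence
the formula, do not change if a coordinate is dualised. -/
def sigmaExt (j : P → D) (f : P → P → P) (x y : D) : D :=
  sSup {c | ∃ M ∈ nbhds j x, ∃ N ∈ nbhds j y, c = sInf {d | ∃ a ∈ M, ∃ b ∈ N, d = j (f a b)}}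

/-- The `π`-extension of a binary operation:
`f^π(x) = ⋀ { ⋁ { f(a) | a ∈ P², p ≤ a ≤ q } | p closed, q open, p ≤ x ≤ q }`. -/
def piExt (j : P → D) (f : P → P → P) (x y : D) : D :=
  sInf {c | ∃ M ∈ nbhds j x, ∃ N ∈ nbhds j y, c = sSup {d | ∃ a ∈ M, ∃ b ∈ N, d = j (f a b)}}

/-- The algebra `A^σ = ⟨A^σ, ∧, ∨, ·^σ, \^π, /^π, e, 0⟩` on a canonical extension `j : A → D` of the
lattice reduct of the FL-algebra `A`. (The extensions of the lattice operations of `A` are those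
of `D`.) -/
def canonicalAlg (A : Bundled.{u} FLAlgebra) (j : A → D) : Bundled.{u} flLang.Structure :=
  letI := A.str
  ⟨D, mkStructure (fun a b => a ⊓ b) (fun a b => a ⊔ b) (sigmaExt j (fun a b => a * b))
    (piExt j FLAlgebra.ldiv) (piExt j FLAlgebra.rdiv) (j 1) (j FLAlgebra.falsum)⟩

end Canonical

/-- `C` is closed under canonical extensions: for every `A` in `C`, the canonical extension of `A`
is isomorphic to a member of `C`. (Canonical extensions are unique up to isomorphism.) -/
def ClosedUnderCanonicalExtensions (C : Set (Bundled.{u} FLAlgebra)) : Prop :=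
  ∀ A ∈ C, letI := A.str
    ∃ (D : Type u) (_ : CompleteLattice D) (j : A → D), IsCanonicalExtension j ∧
      ∃ B ∈ C, Nonempty (toAlg B ≃[flLang] canonicalAlg A j)

/-! ## Terms and equations -/

section Terms

variable {α : Type}

/-- Application of a binary operation symbol. -/
def app (f : FLFunc 2) (s t : flLang.Term α) : flLang.Term α :=
  Term.func (L := flLang) (l := 2) f ![s, t]

/-- The constant `e`. -/
def tOne : flLang.Term α := Term.func (L := flLang) (l := 0) FLFunc.one ![]

/-- The constant `0`. -/
def tFalsum : flLang.Term α := Term.func (L := flLang) (l := 0) FLFunc.falsum ![]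

/-- Powers of a term. -/
def tPow (t : flLang.Term α) : ℕ → flLang.Term α
  | 0 => tOne
  | n + 1 => app FLFunc.mul (tPow t n) t

/-- The inequation `s ≤ t`, that is, the equation `s ∧ t ≈ s`. -/
def leEqn (s t : flLang.Term α) : Eqn flLang α := (app FLFunc.meet s t, s)

end Terms

/-- The variables. -/
def tVar (i : ℕ) : flLang.Term ℕ := Term.var i

/-- `(e ∧ x)^(n+1) ≈ (e ∧ x)^n` -/
def potencyEqn (n : ℕ) : Eqn flLang ℕ :=
  (tPow (app FLFunc.meet tOne (tVar 0)) (n + 1), tPow (app FLFunc.meet tOne (tVar 0)) n)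

/-- The variety of all FL-algebras that satisfy the equations in `E`. -/
def flVariety (E : Set (Eqn flLang ℕ)) : Set (Bundled.{u} flLang.Structure) :=
  {M | (∃ A : Bundled.{u} FLAlgebra, M = toAlg A) ∧ ∀ ε ∈ E, ∀ v : ℕ → M, ε.Holds v}

/-- Commutativity `xy ≈ yx`. -/
def exchangeAx : Set (Eqn flLang ℕ) :=
  {(app FLFunc.mul (tVar 0) (tVar 1), app FLFunc.mul (tVar 1) (tVar 0))}

/-- Integrality and zero-boundedness: `x ≤ e` and `0 ≤ x`. -/
def weakeningAx : Set (Eqn flLang ℕ) :=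
  {leEqn (tVar 0) tOne, leEqn tFalsum (tVar 0)}

/-- Involutivity: `0/(x\0) ≈ x ≈ (0/x)\0`. -/
def involutionAx : Set (Eqn flLang ℕ) :=
  {(app FLFunc.rdiv tFalsum (app FLFunc.ldiv (tVar 0) tFalsum), tVar 0),
   (app FLFunc.ldiv (app FLFunc.rdiv tFalsum (tVar 0)) tFalsum, tVar 0)}

end UnifInterp

open UnifInterp

namespace UnifInterp

/-! ### Equations under homomorphisms, embeddings, renaming and products -/

section UniversalAlgebra

variable {L : FirstOrder.Language.{0, 0}}

/-! Consider the three relations `z ≤ x ≤ e` and `x = x(e ∧ y)`. They force `z ≤ x = x(e ∧ y)^k ≤ (e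
∧ y)^k` for every `k`. Suppose that, conversely, whenever `z` lies below all powers of `e ∧ y` in a
member of `V`, such an `x` exists in some extension within `V` (`FixpointExtension`). Then the
consequences in `y, z` of these finitely many relations are exactly the consequences of the infinite
descending chain `z ≤ (e ∧ y)^k`. No finite set is equivalent to that chain: by compactness of
equational consequence a single `z ≤ (e ∧ y)^n` would imply the next inequality, and `z := (e ∧
y)^n` would give the excluded identity `(e ∧ y)^(n+1) = (e ∧ y)^n`.

Each of the three properties would supply a finite equivalent. A uniform interpolant is one
directly. Coherence gives one as a finite presentation of the subalgebra generated by `y, z` in the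
algebra presented by the three relations. In the models of a model companion, `∃ x` of the relations
is equivalent to the whole chain, so first-order compactness cuts the chain down to a finite part.

It remains to produce fixpoints. In (a), `x` is the meet of the powers of `e ∧ y` in the canonical
extension; compactness of the extension shows that it is fixed by the `σ`-extension of
multiplication. For members of `ISP(C)` this is done in every factor (`fixpointExtension_isp`).

In (b), the fixpoint is found in the Dedekind–MacNeille completion of a reduced power of the algebra
over the cofinite filter of `ℕ`. The completion preserves all the axioms concerned. Multiplication
need not commute with meets there, but the reduced power is saturated enough for the cut below all
powers of `e ∧ y` to be fixed (`exists_pow_le_germ`, `Cut.powers_eq_mul`). Finite Łukasiewicz chains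
satisfy all the axioms and refute each potency identity. -/

theorem Eqn.Holds.map {α : Type} {A B : Type u} [L.Structure A] [L.Structure B] {ε : Eqn L α}
    {v : α → A} (h : ε.Holds v) (f : A →[L] B) : ε.Holds (f ∘ v) := by
  unfold Eqn.Holds at *
  rw [HomClass.realize_term f, HomClass.realize_term f, h]

theorem Eqn.holds_comp_iff {α : Type} {A B : Type u} [L.Structure A] [L.Structure B]
    {ε : Eqn L α} {v : α → A} (f : A ↪[L] B) : ε.Holds (f ∘ v) ↔ ε.Holds v := by
  unfold Eqn.Holds
  rw [HomClass.realize_term f, HomClass.realize_term f, f.injective.eq_iff]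

theorem Eqn.holds_relabel {α β : Type} {A : Type u} [L.Structure A] {ε : Eqn L α} {g : α → β}
    {v : β → A} : (ε.relabel g).Holds v ↔ ε.Holds (v ∘ g) := by
  simp [Eqn.Holds, Eqn.relabel]

theorem realize_pi {I : Type u} (B : I → Type u) [∀ i, L.Structure (B i)] {α : Type}
    (t : L.Term α) (v : α → ∀ i, B i) (i : I) :
    t.realize v i = t.realize (fun a => v a i) := by
  induction t with
  | var => rfl
  | func f ts ih =>
    simp only [Term.realize]
    rw [← funext ih]
    rfl

theorem Eqn.holds_pi_iff {I : Type u} (B : I → Type u) [∀ i, L.Structure (B i)] {α : Type}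
    {ε : Eqn L α} {v : α → ∀ i, B i} :
    ε.Holds v ↔ ∀ i, ε.Holds (fun a => v a i) := by
  unfold Eqn.Holds
  simp only [funext_iff, realize_pi]

theorem IsVariety.mem_of_embedding {V : Set (Bundled.{u} L.Structure)} (hV : IsVariety V)
    {A B : Bundled.{u} L.Structure} (hB : B ∈ V) (f : A ↪[L] B) : A ∈ V := by
  obtain ⟨E, hE⟩ := hV
  rw [hE] at hB ⊢
  exact fun ε hε v => (Eqn.holds_comp_iff f).1 (hB ε hε _)

theorem Entails.mono {V : Set (Bundled.{u} L.Structure)} {α : Type} {E F : Set (Eqn L α)}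
    (h : E ⊆ F) {ε : Eqn L α} (hε : Entails V E ε) : Entails V F ε :=
  fun A hA v hv => hε A hA v fun δ hδ => hv δ (h hδ)

/-! ### Presented algebras and compactness of equational consequence -/

section Presented

variable (V : Set (Bundled.{u} L.Structure)) {α : Type} (E : Set (Eqn L α))

/-- The congruence of consequences of finite subsets of `E` on the (lifted) term algebra. -/
def consequenceSetoid : Setoid (ULift.{u} (L.Term α)) where
  r s t := ∃ F ⊆ E, F.Finite ∧ Entails V F (s.down, t.down)
  iseqv :=
    { refl := fun _ => ⟨∅, Set.empty_subset _, Set.finite_empty, fun _ _ _ _ => rfl⟩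
      symm := fun ⟨F, h, hF, h'⟩ => ⟨F, h, hF, fun A hA v hv => (h' A hA v hv).symm⟩
      trans := fun ⟨F, h, hF, h'⟩ ⟨G, k, hG, k'⟩ =>
        ⟨F ∪ G, Set.union_subset h k, hF.union hG, fun A hA v hv =>
          (Entails.mono Set.subset_union_left h' A hA v hv).trans
            (Entails.mono Set.subset_union_right k' A hA v hv)⟩ }

/-- The carrier of the algebra of `V` presented by the generators `α` and the relations `E`. -/
def PresentedCarrier : Type u := Quotient (consequenceSetoid V E)

variable {E} in
/-- The element of the presented algebra that is denoted by a term. -/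
def presentedMk (t : L.Term α) : PresentedCarrier V E :=
  Quotient.mk (consequenceSetoid V E) ⟨t⟩

variable {V E}

theorem presentedMk_eq_iff {s t : L.Term α} :
    (presentedMk V s : PresentedCarrier V E) = presentedMk V t ↔
      ∃ F ⊆ E, F.Finite ∧ Entails V F (s, t) :=
  Quotient.eq (r := consequenceSetoid V E)

/-- A term that denotes a given element of a presented algebra. -/
noncomputable def presentedOut (q : PresentedCarrier V E) : L.Term α := (Quotient.out q).down

@[simp]
theorem presentedMk_out (q : PresentedCarrier V E) : presentedMk V (presentedOut q) = q :=
  Quotient.out_eq q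

/-- Relations are empty, so maps out of the presented algebra need to respect only the operations,
whatever the language. -/
noncomputable instance : L.Structure (PresentedCarrier V E) where
  funMap f xs := presentedMk V (Term.func f fun i => presentedOut (xs i))
  RelMap _ _ := False

/-- Arities are finite, so the finite sets of relations used in the separate arguments have a finite
union. -/
theorem presentedMk_func {n : ℕ} (f : L.Functions n) (ts : Fin n → L.Term α) :
    (presentedMk V (Term.func f ts) : PresentedCarrier V E) =
      Structure.funMap f fun i => presentedMk V (ts i) := by
  have h : ∀ i, ∃ F ⊆ E, F.Finite ∧
      Entails V F (ts i, presentedOut (presentedMk V (ts i) : PresentedCarrier V E)) := fun i =>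
    presentedMk_eq_iff.1 (presentedMk_out _).symm
  choose F hFE hF hent using h
  refine presentedMk_eq_iff.2 ⟨⋃ i, F i, Set.iUnion_subset hFE, Set.finite_iUnion hF, ?_⟩
  intro A hA v hv
  simp only [Eqn.Holds, Term.realize]
  congr 1
  funext i
  exact hent i A hA v fun δ hδ => hv δ (Set.mem_iUnion_of_mem i hδ)

theorem realize_presentedMk {β : Type} (t : L.Term β) (σ : β → L.Term α) :
    t.realize (fun b => (presentedMk V (σ b) : PresentedCarrier V E)) =
      presentedMk V (t.subst σ) := by
  induction t with
  | var => rfl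
  | func f ts ih =>
    simp only [Term.realize, Term.subst, ih]
    rw [← presentedMk_func]

theorem subst_var (t : L.Term α) : t.subst (fun a => (Term.var a : L.Term α)) = t := by
  induction t with
  | var => rfl
  | func f ts ih => simp only [Term.subst, ih]

theorem realize_presented_generators (t : L.Term α) :
    t.realize (fun a => (presentedMk V (Term.var a) : PresentedCarrier V E)) =
      presentedMk V t := by
  rw [realize_presentedMk, subst_var]

theorem holds_presented_generators_iff {ε : Eqn L α} :
    ε.Holds (fun a => (presentedMk V (Term.var a) : PresentedCarrier V E)) ↔
      ∃ F ⊆ E, F.Finite ∧ Entails V F ε := by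
  unfold Eqn.Holds
  rw [realize_presented_generators, realize_presented_generators, presentedMk_eq_iff]

theorem holds_presented_generators {ε : Eqn L α} (hε : ε ∈ E) :
    ε.Holds (fun a => (presentedMk V (Term.var a) : PresentedCarrier V E)) :=
  holds_presented_generators_iff.2
    ⟨{ε}, by simpa using hε, Set.finite_singleton _, fun _ _ _ hv => hv ε rfl⟩

variable (V E) in
/-- The algebra of `V` presented by the generators `α` and the relations `E`. -/
noncomputable abbrev presented : Bundled.{u} L.Structure := ⟨PresentedCarrier V E, inferInstance⟩

theorem IsVariety.presented_mem (hV : IsVariety V) : presented V E ∈ V := by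
  obtain ⟨X, hX⟩ := hV
  rw [hX]
  intro ε hε v
  have hv : v = fun n => presentedMk V (presentedOut (v n)) :=
    funext fun n => (presentedMk_out _).symm
  unfold Eqn.Holds
  rw [hv]
  erw [realize_presentedMk, realize_presentedMk]
  refine presentedMk_eq_iff.2 ⟨∅, Set.empty_subset _, Set.finite_empty, fun A hA w _ => ?_⟩
  simp only [Eqn.Holds, Term.realize_subst]
  exact (hX A).1 hA ε hε _

/-- Equational consequence in a variety is compact. -/
theorem IsVariety.exists_finite_entails (hV : IsVariety V) {ε : Eqn L α} (h : Entails V E ε) :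
    ∃ F ⊆ E, F.Finite ∧ Entails V F ε :=
  -- The algebra whose equalities are the finitely derivable ones is itself in `V` and satisfies
  -- `E`, so whatever `E` entails is finitely derivable.
  holds_presented_generators_iff.1 <|
    h (presented V E) hV.presented_mem _ fun _ hδ => holds_presented_generators hδ

/-- The homomorphism from a presented algebra given by elements that satisfy the relations. -/
noncomputable def presentedLift {B : Bundled.{u} L.Structure} (hB : B ∈ V) (h : α → B)
    (hh : ∀ ε ∈ E, ε.Holds h) : presented V E →[L] B where
  toFun q := (presentedOut q).realize h
  map_fun' f xs := by
    obtain ⟨F, hFE, -, hF⟩ := presentedMk_eq_iff.1 (presentedMk_out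
      (presentedMk V (Term.func f fun i => presentedOut (xs i)) : PresentedCarrier V E))
    exact hF B hB h fun δ hδ => hh δ (hFE hδ)
  map_rel' _ _ h := False.elim h

theorem presentedLift_mk {B : Bundled.{u} L.Structure} (hB : B ∈ V) (h : α → B)
    (hh : ∀ ε ∈ E, ε.Holds h) (t : L.Term α) :
    presentedLift hB h hh (presentedMk V t : PresentedCarrier V E) = t.realize h := by
  obtain ⟨F, hFE, -, hF⟩ := presentedMk_eq_iff.1 (presentedMk_out
    (presentedMk V t : PresentedCarrier V E))
  exact hF B hB h fun δ hδ => hh δ (hFE hδ)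

end Presented

theorem mem_closure_range_iff {M : Type u} [L.Structure M] {ι : Type} {g : ι → M} {x : M} :
    x ∈ Substructure.closure L (Set.range g) ↔ ∃ t : L.Term ι, t.realize g = x := by
  rw [Substructure.mem_closure_iff_exists_term]
  constructor
  · rintro ⟨t, rfl⟩
    refine ⟨t.relabel fun y => y.2.choose, ?_⟩
    rw [Term.realize_relabel]
    congr 1
    funext y
    exact y.2.choose_spec
  · rintro ⟨t, rfl⟩
    exact ⟨t.relabel (Set.rangeFactorization g), by rw [Term.realize_relabel]; rfl⟩

theorem IsVariety.finitelyPresented_presented {V : Set (Bundled.{u} L.Structure)}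
    (hV : IsVariety V) {n : ℕ} {E : Set (Eqn L (Fin n))} (hE : E.Finite) :
    FinitelyPresented V (presented V E) := by
  refine ⟨hV.presented_mem, n, E, fun i => presentedMk V (Term.var i), hE, ?_,
    fun ε hε => holds_presented_generators hε,
    fun B hB h hh => ⟨presentedLift hB h hh, fun i => presentedLift_mk hB h hh _⟩⟩
  rw [eq_top_iff]
  intro q _
  rw [mem_closure_range_iff]
  exact ⟨presentedOut q, (realize_presented_generators _).trans (presentedMk_out q)⟩

/-! ### First-order theories of varieties -/

/-- Expresses a universal closure as a negated existential closure, so that the identities of a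
variety become sentences. -/
theorem realize_not_exClosure_not_iff {M : Type u} [L.Structure M] [Nonempty M]
    (φ : L.Formula ℕ) : M ⊨ φ.not.exClosure.not ↔ ∀ v : ℕ → M, φ.Realize v := by
  rw [Sentence.Realize, Formula.realize_not, ← not_exists_not, not_iff_not]
  rw [← Sentence.Realize, ← Formula.exists_realize_equivSentence_iff_realize_exClosure]
  refine exists_congr fun v => ?_
  rw [← Formula.realize_not, ← Formula.realize_equivSentence_symm, Equiv.symm_apply_apply]

/-- The theory of `V` contains the universal closures of the defining equations of `V`, so its
models are members of `V`. -/
theorem IsVariety.mem_of_models {V : Set (Bundled.{u} L.Structure)} (hV : IsVariety V)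
    (hne : ∀ A ∈ V, Nonempty A) (M : Bundled.{u} L.Structure) [Nonempty M]
    (hM : M ⊨ theoryOf V) : M ∈ V := by
  obtain ⟨E, hE⟩ := hV
  rw [hE]
  intro ε hε v
  have key : (Term.equal ε.1 ε.2 : L.Formula ℕ).not.exClosure.not ∈ theoryOf V := by
    intro A hA
    have := hne A hA
    rw [realize_not_exClosure_not_iff]
    exact fun v => Formula.realize_equal.2 ((hE A).1 hA ε hε v)
  exact Formula.realize_equal.1
    ((realize_not_exClosure_not_iff _).1 (hM.realize_of_mem _ key) v)

end UniversalAlgebra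

/-! ## FL-algebras as structures -/

instance flStructure (A : Type u) [FLAlgebra A] : flLang.Structure A :=
  (toAlg ⟨A, inferInstance⟩).str

instance : flLang.IsAlgebraic := fun _ => inferInstanceAs (IsEmpty Empty)

/-- The bundled `flLang`-structure of an FL-algebra. -/
abbrev flAlg (A : Type u) [FLAlgebra A] : Bundled.{u} flLang.Structure := ⟨A, flStructure A⟩

section Realize

variable {α : Type}

theorem realize_app {M : Type u} [flLang.Structure M] (f : FLFunc 2) (s t : flLang.Term α)
    (v : α → M) :
    (app f s t).realize v = Structure.funMap (L := flLang) (n := 2) f ![s.realize v, t.realize v] := by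
  simp only [app, Term.realize]
  congr 1
  funext i
  fin_cases i <;> rfl

theorem realize_tOne' {M : Type u} [flLang.Structure M] (v : α → M) :
    (tOne : flLang.Term α).realize v =
      Structure.funMap (L := flLang) (n := 0) FLFunc.one ![] := by
  simp only [tOne, Term.realize]
  congr 1
  funext i
  exact i.elim0

variable {A : Type u} [FLAlgebra A] (s t : flLang.Term α) (v : α → A)

@[simp] theorem realize_meet :
    (app FLFunc.meet s t).realize v = s.realize v ⊓ t.realize v := rfl

@[simp] theorem realize_join :
    (app FLFunc.join s t).realize v = s.realize v ⊔ t.realize v := rfl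

@[simp] theorem realize_mul :
    (app FLFunc.mul s t).realize v = s.realize v * t.realize v := rfl

@[simp] theorem realize_ldiv :
    (app FLFunc.ldiv s t).realize v = FLAlgebra.ldiv (s.realize v) (t.realize v) := rfl

@[simp] theorem realize_rdiv :
    (app FLFunc.rdiv s t).realize v = FLAlgebra.rdiv (s.realize v) (t.realize v) := rfl

@[simp] theorem realize_tOne : (tOne : flLang.Term α).realize v = 1 := rfl

@[simp] theorem realize_tVar (v : ℕ → A) (i : ℕ) : (tVar i).realize v = v i := rfl

@[simp] theorem realize_tPow (n : ℕ) : (tPow t n).realize v = t.realize v ^ n := by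
  induction n with
  | zero => simp [tPow]
  | succ n ih => simp [tPow, ih, pow_succ]

@[simp] theorem holds_leEqn : (leEqn s t).Holds v ↔ s.realize v ≤ t.realize v := by
  simp [Eqn.Holds, leEqn]

end Realize

/-! ### FL-algebras form a variety -/

section Residuation

variable {A : Type u} [FLAlgebra A]

instance : MulLeftMono A := ⟨fun a b c h => by
  rw [← FLAlgebra.le_ldiv_iff]
  exact h.trans ((FLAlgebra.le_ldiv_iff _ _ _).2 le_rfl)⟩

instance : MulRightMono A := ⟨fun a b c h => by
  change b * a ≤ c * a
  rw [← FLAlgebra.le_rdiv_iff]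
  exact h.trans ((FLAlgebra.le_rdiv_iff _ _ _).2 le_rfl)⟩

theorem mul_ldiv_le (a c : A) : a * FLAlgebra.ldiv a c ≤ c :=
  (FLAlgebra.le_ldiv_iff _ _ _).1 le_rfl

theorem rdiv_mul_le (c b : A) : FLAlgebra.rdiv c b * b ≤ c :=
  (FLAlgebra.le_rdiv_iff _ _ _).1 le_rfl

theorem mul_sup_eq (a b c : A) : a * (b ⊔ c) = a * b ⊔ a * c :=
  le_antisymm
    ((FLAlgebra.le_ldiv_iff _ _ _).1 (sup_le ((FLAlgebra.le_ldiv_iff _ _ _).2 le_sup_left)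
      ((FLAlgebra.le_ldiv_iff _ _ _).2 le_sup_right)))
    (sup_le (mul_le_mul_right le_sup_left a) (mul_le_mul_right le_sup_right a))

theorem sup_mul_eq (a b c : A) : (a ⊔ b) * c = a * c ⊔ b * c :=
  le_antisymm
    ((FLAlgebra.le_rdiv_iff _ _ _).1 (sup_le ((FLAlgebra.le_rdiv_iff _ _ _).2 le_sup_left)
      ((FLAlgebra.le_rdiv_iff _ _ _).2 le_sup_right)))
    (sup_le (mul_le_mul_left le_sup_left c) (mul_le_mul_left le_sup_right c))

end Residuation

section Axioms

local notation "x₀" => tVar 0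
local notation "x₁" => tVar 1
local notation "x₂" => tVar 2
local infixl:65 " ⋁ " => app FLFunc.join
local infixl:65 " ⋀ " => app FLFunc.meet
local infixl:70 " ⊙ " => app FLFunc.mul

/-- Equational axioms for FL-algebras. -/
def flAx : Set (Eqn flLang ℕ) :=
  {(x₀ ⋁ x₁, x₁ ⋁ x₀), ((x₀ ⋁ x₁) ⋁ x₂, x₀ ⋁ (x₁ ⋁ x₂)),
   (x₀ ⋀ x₁, x₁ ⋀ x₀), ((x₀ ⋀ x₁) ⋀ x₂, x₀ ⋀ (x₁ ⋀ x₂)),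
   (x₀ ⋁ (x₀ ⋀ x₁), x₀), (x₀ ⋀ (x₀ ⋁ x₁), x₀),
   ((x₀ ⊙ x₁) ⊙ x₂, x₀ ⊙ (x₁ ⊙ x₂)), (tOne ⊙ x₀, x₀), (x₀ ⊙ tOne, x₀),
   (x₀ ⊙ (x₁ ⋁ x₂), (x₀ ⊙ x₁) ⋁ (x₀ ⊙ x₂)), ((x₀ ⋁ x₁) ⊙ x₂, (x₀ ⊙ x₂) ⋁ (x₁ ⊙ x₂)),
   ((x₀ ⊙ app FLFunc.ldiv x₀ x₁) ⋁ x₁, x₁), ((app FLFunc.rdiv x₁ x₀ ⊙ x₀) ⋁ x₁, x₁),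
   (x₁ ⋁ app FLFunc.ldiv x₀ ((x₀ ⊙ x₁) ⋁ x₂), app FLFunc.ldiv x₀ ((x₀ ⊙ x₁) ⋁ x₂)),
   (x₁ ⋁ app FLFunc.rdiv ((x₁ ⊙ x₀) ⋁ x₂) x₀, app FLFunc.rdiv ((x₁ ⊙ x₀) ⋁ x₂) x₀)}

theorem holds_flAx (A : Type u) [FLAlgebra A] : ∀ ε ∈ flAx, ∀ v : ℕ → A, ε.Holds v := by
  simp only [flAx, Set.mem_insert_iff, Set.mem_singleton_iff, forall_eq_or_imp, forall_eq,
    Eqn.Holds, realize_meet, realize_join, realize_mul, realize_ldiv, realize_rdiv, realize_tOne,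
    realize_tVar]
  refine ⟨fun v => sup_comm _ _, fun v => sup_assoc _ _ _, fun v => inf_comm _ _,
    fun v => inf_assoc _ _ _, fun v => sup_inf_self, fun v => inf_sup_self,
    fun v => mul_assoc _ _ _, fun v => one_mul _, fun v => mul_one _, fun v => mul_sup_eq _ _ _,
    fun v => sup_mul_eq _ _ _, fun v => sup_eq_right.2 (mul_ldiv_le _ _),
    fun v => sup_eq_right.2 (rdiv_mul_le _ _),
    fun v => sup_eq_right.2 ((FLAlgebra.le_ldiv_iff _ _ _).2 le_sup_left),
    fun v => sup_eq_right.2 ((FLAlgebra.le_rdiv_iff _ _ _).2 le_sup_left)⟩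

theorem exists_flAlgebra_of_holds (M : Type u) [S : flLang.Structure M]
    (h : ∀ ε ∈ flAx, ∀ v : ℕ → M, ε.Holds v) :
    ∃ _ : FLAlgebra M, S = flStructure M := by
  -- The axioms use only the first three variables.
  let asg (x y z : M) : ℕ → M := fun n => Nat.casesOn n x fun m => Nat.casesOn m y fun _ => z
  have h' : ∀ ε ∈ flAx, ∀ x y z : M, ε.Holds (asg x y z) := fun ε hε x y z => h ε hε _
  let op (f : FLFunc 2) (x y : M) : M := Structure.funMap (L := flLang) (n := 2) f ![x, y]
  let one : M := Structure.funMap (L := flLang) (n := 0) FLFunc.one ![]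
  have hop : ∀ (f : FLFunc 2) (x y : M),
    Structure.funMap (L := flLang) (n := 2) f ![x, y] = op f x y := fun _ _ _ => rfl
  have hone : Structure.funMap (L := flLang) (n := 0) FLFunc.one ![] = one := rfl
  have h0 : ∀ x y z : M, (tVar 0).realize (asg x y z) = x := fun _ _ _ => rfl
  have h1 : ∀ x y z : M, (tVar 1).realize (asg x y z) = y := fun _ _ _ => rfl
  have h2 : ∀ x y z : M, (tVar 2).realize (asg x y z) = z := fun _ _ _ => rfl
  simp only [flAx, Set.mem_insert_iff, Set.mem_singleton_iff, forall_eq_or_imp, forall_eq,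
    Eqn.Holds, realize_app, realize_tOne', h0, h1, h2, hop, hone] at h'
  obtain ⟨a1, a2, a3, a4, a5, a6, a7, a8, a9, a10, a11, a12, a13, a14, a15⟩ := h'
  let : Max M := ⟨op FLFunc.join⟩
  let : Min M := ⟨op FLFunc.meet⟩
  let lat : Lattice M := Lattice.mk' (fun a b => a1 a b a) (fun a b c => a2 a b c)
    (fun a b => a3 a b a) (fun a b c => a4 a b c) (fun a b => a5 a b a) (fun a b => a6 a b a)
  let mon : Monoid M :=
    { mul := op FLFunc.mul
      one := one
      mul_assoc := a7
      one_mul := fun a => a8 a a a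
      mul_one := fun a => a9 a a a }
  have b10 : ∀ x y z : M, x * (y ⊔ z) = x * y ⊔ x * z := a10
  have b11 : ∀ x y z : M, (x ⊔ y) * z = x * z ⊔ y * z := a11
  have b12 : ∀ x y : M, x * op FLFunc.ldiv x y ≤ y := fun x y => sup_eq_right.1 (a12 x y y)
  have b13 : ∀ x y : M, op FLFunc.rdiv y x * x ≤ y := fun x y => sup_eq_right.1 (a13 x y y)
  have b14 : ∀ x y z : M, y ≤ op FLFunc.ldiv x (x * y ⊔ z) := fun x y z =>
    sup_eq_right.1 (a14 x y z)
  have b15 : ∀ x y z : M, y ≤ op FLFunc.rdiv (y * x ⊔ z) x := fun x y z =>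
    sup_eq_right.1 (a15 x y z)
  -- Distributivity over joins gives monotonicity. With `a ≤ b` read as `a ∨ b = b`, the last four
  -- axioms then yield residuation: if `ab ≤ c` then `ab ∨ c = c`, so the axiom `b ≤ a \ (ab ∨ c)`
  -- becomes `b ≤ a \ c`.
  have monoL : ∀ x y z : M, y ≤ z → x * y ≤ x * z := fun x y z hyz => by
    rw [← sup_eq_right] at hyz ⊢
    rw [← b10, hyz]
  have monoR : ∀ x y z : M, y ≤ z → y * x ≤ z * x := fun x y z hyz => by
    rw [← sup_eq_right] at hyz ⊢
    rw [← b11, hyz]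
  refine ⟨{ lat, mon with
    ldiv := op FLFunc.ldiv
    rdiv := op FLFunc.rdiv
    falsum := Structure.funMap (L := flLang) (n := 0) FLFunc.falsum ![]
    le_ldiv_iff := fun a b c => ⟨fun hb => (monoL a _ _ hb).trans (b12 a c), fun hb => by
      simpa only [sup_eq_right.2 hb] using b14 a b c⟩
    le_rdiv_iff := fun a b c => ⟨fun hb => (monoR b _ _ hb).trans (b13 b c), fun hb => by
      simpa only [sup_eq_right.2 hb] using b15 b a c⟩ }, ?_⟩
  have e2 : ∀ v : Fin 2 → M, v = ![v 0, v 1] := fun v => by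
    funext i; fin_cases i <;> rfl
  have e0 : ∀ v : Fin 0 → M, v = ![] := fun v => by
    funext i; exact i.elim0
  ext n f v
  · cases f <;> first
      | (rw [e2 v]; rfl)
      | (rw [e0 v]; rfl)
  · exact Empty.elim f

end Axioms

theorem isVariety_flVariety (E : Set (Eqn flLang ℕ)) : IsVariety (flVariety.{u} E) := by
  refine ⟨flAx ∪ E, fun M => ⟨?_, fun h => ⟨?_, fun ε hε => h ε (.inr hε)⟩⟩⟩
  · rintro ⟨⟨A, rfl⟩, hA⟩ ε (hε | hε)
    · let := A.str
      exact holds_flAx A ε hε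
    · exact hA ε hε
  · obtain ⟨inst, hS⟩ := exists_flAlgebra_of_holds M fun ε hε => h ε (.inl hε)
    refine ⟨⟨M, inst⟩, ?_⟩
    exact congrArg (fun S => (⟨M.α, S⟩ : Bundled.{u} flLang.Structure)) hS

theorem flAlg_mem_flVariety_iff {A : Type u} [FLAlgebra A] {E : Set (Eqn flLang ℕ)} :
    flAlg A ∈ flVariety E ↔ ∀ ε ∈ E, ∀ v : ℕ → A, ε.Holds v :=
  ⟨fun h => h.2, fun h => ⟨⟨⟨A, inferInstance⟩, rfl⟩, h⟩⟩

theorem exists_flAlg_of_mem_flVariety {E : Set (Eqn flLang ℕ)} {M : Bundled.{u} flLang.Structure}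
    (hM : M ∈ flVariety E) : ∃ (A : Type u) (_ : FLAlgebra A), M = flAlg A := by
  obtain ⟨⟨A, rfl⟩, -⟩ := hM
  exact ⟨A.α, A.str, rfl⟩

/-! ## The fixpoint argument -/

section Fixpoint

variable {α : Type}

/-- The relations `z ≤ x ≤ e` and `x ≈ x(e ∧ y)`. -/
def fixEqns (x y z : α) : Set (Eqn flLang α) :=
  {leEqn (Term.var z) (Term.var x), leEqn (Term.var x) tOne,
    (Term.var x, app FLFunc.mul (Term.var x) (app FLFunc.meet tOne (Term.var y)))}

/-- The relation `z ≤ (e ∧ y)^k`. -/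
def chainEqn (y z : α) (k : ℕ) : Eqn flLang α :=
  leEqn (Term.var z) (tPow (app FLFunc.meet tOne (Term.var y)) k)

theorem finite_fixEqns (x y z : α) : (fixEqns x y z).Finite := by
  simp [fixEqns]

theorem relabel_app {β : Type} (g : α → β) (f : FLFunc 2) (s t : flLang.Term α) :
    (app f s t).relabel g = app f (s.relabel g) (t.relabel g) := by
  simp only [app, Term.relabel]
  congr 1
  funext i
  fin_cases i <;> rfl

theorem relabel_tOne {β : Type} (g : α → β) :
    (tOne : flLang.Term α).relabel g = tOne := by
  simp only [tOne, Term.relabel]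
  congr 1
  funext i
  exact i.elim0

theorem relabel_fixEqns {β : Type} (g : α → β) (x y z : α) :
    (fun δ : Eqn flLang α => δ.relabel g) '' fixEqns x y z = fixEqns (g x) (g y) (g z) := by
  simp [fixEqns, Set.image_insert_eq, Eqn.relabel, leEqn, relabel_app, relabel_tOne]

theorem relabel_chainEqn {β : Type} (g : α → β) (y z : α) (k : ℕ) :
    (chainEqn y z k).relabel g = chainEqn (g y) (g z) k := by
  have h : ∀ k, (tPow (app FLFunc.meet tOne (Term.var y : flLang.Term α)) k).relabel g =
      tPow (app FLFunc.meet tOne (Term.var (g y))) k := by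
    intro k
    induction k with
    | zero => exact relabel_tOne g
    | succ k ih => simp [tPow, relabel_app, ih, relabel_tOne]
  simp [chainEqn, leEqn, Eqn.relabel, relabel_app, h]

theorem holds_fixEqns_iff {A : Type u} [FLAlgebra A] {x y z : α} {v : α → A} :
    (∀ δ ∈ fixEqns x y z, δ.Holds v) ↔ v z ≤ v x ∧ v x ≤ 1 ∧ v x = v x * (1 ⊓ v y) := by
  simp only [fixEqns, Set.mem_insert_iff, Set.mem_singleton_iff, forall_eq_or_imp, forall_eq,
    holds_leEqn]
  simp [Eqn.Holds]

@[simp]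
theorem holds_chainEqn_iff {A : Type u} [FLAlgebra A] {y z : α} {v : α → A} {k : ℕ} :
    (chainEqn y z k).Holds v ↔ v z ≤ (1 ⊓ v y) ^ k := by
  simp [chainEqn]

theorem unitMeet_pow_anti {A : Type u} [FLAlgebra A] (y : A) :
    Antitone fun k : ℕ => (1 ⊓ y) ^ k :=
  antitone_nat_of_succ_le fun k => by
    rw [pow_succ]
    exact (mul_le_mul_right inf_le_left _).trans (mul_one _).le

variable (V : Set (Bundled.{u} flLang.Structure))

/-- Elements below all powers of `e ∧ y` are, in some extension, below a fixpoint of multiplication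
by `e ∧ y` that is at most `e`. -/
def FixpointExtension : Prop :=
  ∀ A ∈ V, ∀ y z : A, (∀ k, (chainEqn (0 : Fin 2) 1 k).Holds ![y, z]) →
    ∃ B ∈ V, ∃ (f : A ↪[flLang] B) (x : B),
      ∀ δ ∈ fixEqns (0 : Fin 3) 1 2, δ.Holds ![x, f y, f z]

variable {V} (hFL : V ⊆ flVariety ∅)

include hFL

theorem entails_chainEqn (x y z : α) (k : ℕ) :
    Entails V (fixEqns x y z) (chainEqn y z k) := by
  intro A hA v hv
  obtain ⟨A, _, rfl⟩ := exists_flAlg_of_mem_flVariety (hFL hA)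
  obtain ⟨hzx, hx, hfix⟩ := holds_fixEqns_iff.1 hv
  refine holds_chainEqn_iff.2 (hzx.trans ?_)
  induction k with
  | zero => simpa using hx
  | succ k ih =>
    rw [hfix, pow_succ]
    exact mul_le_mul_left ih _

/-- The extension property eliminates `x`: an assignment of `y, z` satisfying the chain extends to
one satisfying the relations in a larger algebra, and equations in `y, z` are reflected by the
embedding. -/
theorem FixpointExtension.entails (hfix : FixpointExtension V) {x y z : α} (hxy : x ≠ y)
    (hxz : x ≠ z) (hyz : y ≠ z) {ε : Eqn flLang (Fin 2)}
    (h : Entails V (fixEqns x y z) (ε.relabel ![y, z])) :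
    Entails V (Set.range (chainEqn (0 : Fin 2) 1)) ε := by
  classical
  intro A hA v hv
  have hv2 : v = ![v 0, v 1] := by funext i; fin_cases i <;> rfl
  obtain ⟨B, hB, f, b, hb⟩ := hfix A hA (v 0) (v 1) fun k => by
    rw [← hv2]
    exact hv _ ⟨k, rfl⟩
  obtain ⟨B, _, rfl⟩ := exists_flAlg_of_mem_flVariety (hFL hB)
  let w : α → B := fun a => if a = x then b else if a = y then f (v 0) else f (v 1)
  have hwx : w x = b := if_pos rfl
  have hwy : w y = f (v 0) := by simp [w, hxy.symm]
  have hwz : w z = f (v 1) := by simp [w, hxz.symm, hyz.symm]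
  have := h _ hB w (holds_fixEqns_iff.2 (by
    rw [hwx, hwy, hwz]
    exact holds_fixEqns_iff.1 hb))
  rw [Eqn.holds_relabel, show w ∘ ![y, z] = f ∘ v by
    funext i; fin_cases i <;> simp [hwy, hwz], Eqn.holds_comp_iff f] at this
  exact this

/-- Powers of `e ∧ y` decrease, so any finite part of the chain follows from its inequality with the
largest exponent. -/
theorem exists_pow_of_entails (hV : IsVariety V) {P : Set (Eqn flLang (Fin 2))} (hP : P.Finite)
    (h : ∀ π ∈ P, Entails V (Set.range (chainEqn (0 : Fin 2) 1)) π) :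
    ∃ n : ℕ, ∀ π ∈ P, Entails V {chainEqn (0 : Fin 2) 1 n} π := by
  have key : ∀ π ∈ P, ∃ n : ℕ, Entails V {chainEqn (0 : Fin 2) 1 n} π := by
    intro π hπ
    obtain ⟨F, hF, hfin, hent⟩ := hV.exists_finite_entails (h π hπ)
    obtain ⟨N, -, hNfin, rfl⟩ := (Set.exists_subset_image_finite_and (f := chainEqn (0 : Fin 2) 1)
      (s := Set.univ) (p := (· = F))).1 ⟨F, by simpa using hF, hfin, rfl⟩
    obtain ⟨n, hn⟩ := hNfin.bddAbove
    refine ⟨n, fun A hA v hv => hent A hA v ?_⟩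
    obtain ⟨A, _, rfl⟩ := exists_flAlg_of_mem_flVariety (hFL hA)
    rintro _ ⟨k, hk, rfl⟩
    exact holds_chainEqn_iff.2
      ((holds_chainEqn_iff.1 (hv _ rfl)).trans (unitMeet_pow_anti _ (hn hk)))
  choose! n hn using key
  obtain ⟨m, hm⟩ := (hP.image n).bddAbove
  refine ⟨m, fun π hπ A hA v hv => hn π hπ A hA v ?_⟩
  obtain ⟨A, _, rfl⟩ := exists_flAlg_of_mem_flVariety (hFL hA)
  rintro _ rfl
  exact holds_chainEqn_iff.2 ((holds_chainEqn_iff.1 (hv _ rfl)).trans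
    (unitMeet_pow_anti _ (hm ⟨π, hπ, rfl⟩)))

theorem not_entails_succ (hpot : ∀ n, ¬ Satisfies V (potencyEqn n)) (n : ℕ) :
    ¬ Entails V {chainEqn (0 : Fin 2) 1 n} (chainEqn (0 : Fin 2) 1 (n + 1)) := by
  intro h
  -- Substitute `z := (e ∧ y)^n`; the reverse inequality always holds.
  refine hpot n fun A hA v => ?_
  have := h A hA
  obtain ⟨A, _, rfl⟩ := exists_flAlg_of_mem_flVariety (hFL hA)
  have := this ![v 0, (1 ⊓ v 0) ^ n] (by
    rintro _ rfl
    exact holds_chainEqn_iff.2 le_rfl)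
  have := holds_chainEqn_iff.1 this
  simp only [Eqn.Holds, potencyEqn, realize_tPow, realize_meet, realize_tOne, realize_tVar]
  exact le_antisymm (unitMeet_pow_anti (v 0) n.le_succ) this

variable (hV : IsVariety V) (hfix : FixpointExtension V)
  (hpot : ∀ n, ¬ Satisfies V (potencyEqn n))

include hV hfix hpot

theorem not_uniformDeductiveInterpolation : ¬ UniformDeductiveInterpolation V := by
  intro h
  obtain ⟨P, hP, hPE⟩ := h 1 2 (fixEqns (.inl 0) (.inr 0) (.inr 1)) (finite_fixEqns _ _ _)
  -- No further variables are needed to reach the contradiction.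
  have hPE := hPE 0
  rw [relabel_fixEqns] at hPE
  obtain ⟨n, hn⟩ := exists_pow_of_entails hFL hV hP fun π hπ => by
    refine hfix.entails hFL (x := (.inl 0 : Fin 1 ⊕ (Fin 2 ⊕ Fin 0))) (y := .inr (.inl 0))
      (z := .inr (.inl 1)) (by simp) (by simp) (by simp) ?_
    have := (hPE (π.relabel Sum.inl)).2 fun A hA v hv => hv _ ⟨π, hπ, rfl⟩
    intro A hA v hv
    have := this A hA v hv
    rw [Eqn.holds_relabel, Eqn.holds_relabel] at this
    rw [Eqn.holds_relabel]
    convert this using 1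
    funext i
    fin_cases i <;> rfl
  refine not_entails_succ hFL hpot n fun A hA v hv => ?_
  have := (hPE ((chainEqn 0 1 (n + 1)).relabel Sum.inl)).1 (by
    rw [relabel_chainEqn, relabel_chainEqn]
    exact entails_chainEqn hFL _ _ _ _) A hA (Sum.elim v Fin.elim0) (by
      rintro _ ⟨π, hπ, rfl⟩
      rw [Eqn.holds_relabel]
      exact hn π hπ A hA v hv)
  rwa [Eqn.holds_relabel] at this

theorem not_coherent : ¬ Coherent V := by
  intro h
  let E := fixEqns (0 : Fin 3) 1 2
  let yz : Fin 2 → presented V E :=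
    ![presentedMk V (Term.var 1), presentedMk V (Term.var 2)]
  let S := Substructure.closure flLang (Set.range yz)
  let g : Fin 2 → S := fun i => ⟨yz i, Substructure.subset_closure ⟨i, rfl⟩⟩
  have hS : ∀ ε : Eqn flLang (Fin 2), ε.Holds g ↔
      Entails V (Set.range (chainEqn (0 : Fin 2) 1)) ε := by
    intro ε
    have hyz : yz = (fun a => presentedMk V (Term.var a)) ∘ ![1, 2] := by
      funext i; fin_cases i <;> rfl
    rw [← Eqn.holds_comp_iff S.subtype, show S.subtype ∘ g = yz from rfl, hyz,
      ← Eqn.holds_relabel]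
    constructor
    · intro hε
      obtain ⟨F, hF, -, hent⟩ := holds_presented_generators_iff.1 hε
      exact hfix.entails hFL (by decide) (by decide) (by decide) (hent.mono hF)
    · intro hε
      rw [Eqn.holds_relabel]
      refine hε _ hV.presented_mem _ ?_
      rintro _ ⟨k, rfl⟩
      rw [← Eqn.holds_relabel, relabel_chainEqn]
      exact entails_chainEqn hFL 0 1 2 k _ hV.presented_mem _ fun δ hδ =>
        holds_presented_generators hδ
  obtain ⟨-, m, R, (r : Fin m → S), hR, hgen, hr, huniv⟩ :=
    h _ (hV.finitelyPresented_presented (finite_fixEqns _ _ _)) S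
      (Substructure.fg_def.2 ⟨_, Set.finite_range yz, rfl⟩)
  have hgterm : ∀ i, ∃ t : flLang.Term (Fin m), t.realize r = g i := fun i =>
    mem_closure_range_iff.1 (hgen ▸ Substructure.mem_top _)
  have hrterm : ∀ i, ∃ t : flLang.Term (Fin 2), t.realize g = r i := by
    intro i
    obtain ⟨t, ht⟩ := mem_closure_range_iff.1 (r i).2
    refine ⟨t, Subtype.ext ?_⟩
    rw [← ht]
    exact (HomClass.realize_term S.subtype).symm
  choose p hp using hgterm
  choose s hs using hrterm
  -- Change of generators: the relations `R` rewritten in `y, z`, together with equations saying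
  -- that `y, z` are recovered from the rewritten generators.
  let P : Set (Eqn flLang (Fin 2)) :=
    (fun ε : Eqn flLang (Fin m) => (ε.1.subst s, ε.2.subst s)) '' R ∪
      Set.range fun i => (Term.var i, (p i).subst s)
  obtain ⟨n, hn⟩ := exists_pow_of_entails hFL hV (P := P)
    ((hR.image _).union (Set.finite_range _)) (by
      rintro _ (⟨ε, hε, rfl⟩ | ⟨i, rfl⟩) <;> rw [← hS]
      · have : ε.1.realize r = ε.2.realize r := hr ε hε
        simpa [Eqn.Holds, Term.realize_subst, hs] using this
      · have : (p i).realize r = g i := hp i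
        simp [Eqn.Holds, Term.realize_subst, hs, this])
  refine not_entails_succ hFL hpot n fun A hA v hv => ?_
  -- Any pair satisfying the `n`-th inequality is thus a homomorphic image of the generators of `S`,
  -- and therefore satisfies the whole chain.
  obtain ⟨(f : S →[flLang] A), hf⟩ := huniv A hA (fun i => (s i).realize v) fun ε hε => by
    have := hn _ (.inl ⟨ε, hε, rfl⟩) A hA v hv
    simpa [Eqn.Holds, Term.realize_subst] using this
  have hfg : f ∘ g = v := by
    funext i
    have := hn _ (.inr ⟨i, rfl⟩) A hA v hv
    simp only [Eqn.Holds, Term.realize_subst, Term.realize_var] at this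
    have hp' : (p i).realize r = g i := hp i
    rw [this, Function.comp_apply, ← hp', ← HomClass.realize_term f]
    congr 1
    funext j
    exact hf j
  have hch : (chainEqn (0 : Fin 2) 1 (n + 1)).Holds g :=
    (hS _).2 fun A hA v hv => hv _ ⟨_, rfl⟩
  rw [← hfg]
  exact hch.map f

omit hFL hV hfix hpot

/-- The formula `∃ x, z ≤ x ≤ e ∧ x ≈ x(e ∧ y)`. -/
def fixFormula : flLang.Formula (Fin 2) :=
  let x : flLang.Term (Fin 2 ⊕ Fin 1) := Term.var (.inr 0)
  let y : flLang.Term (Fin 2 ⊕ Fin 1) := Term.var (.inl 0)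
  let z : flLang.Term (Fin 2 ⊕ Fin 1) := Term.var (.inl 1)
  ((leEqn z x).1.bdEqual (leEqn z x).2 ⊓
    ((leEqn x tOne).1.bdEqual (leEqn x tOne).2 ⊓
      x.bdEqual (app FLFunc.mul x (app FLFunc.meet tOne y))) :
    flLang.BoundedFormula (Fin 2) 1).ex

theorem realize_fixFormula {A : Type u} [flLang.Structure A] {v : Fin 2 → A} :
    fixFormula.Realize v ↔
      ∃ x, ∀ δ ∈ fixEqns (0 : Fin 3) 1 2, δ.Holds ![x, v 0, v 1] := by
  have h : ∀ x : A, (∀ δ ∈ fixEqns (0 : Fin 3) 1 2, δ.Holds ![x, v 0, v 1]) ↔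
      ∀ δ ∈ fixEqns (.inr 0 : Fin 2 ⊕ Fin 1) (.inl 0) (.inl 1),
        δ.Holds (Sum.elim v ![x]) := fun x => by
    rw [show fixEqns (.inr 0 : Fin 2 ⊕ Fin 1) (.inl 0) (.inl 1) = _ from
      (relabel_fixEqns ![(.inr 0 : Fin 2 ⊕ Fin 1), .inl 0, .inl 1] (0 : Fin 3) 1 2).symm,
      Set.forall_mem_image]
    refine forall₂_congr fun δ _ => ?_
    rw [Eqn.holds_relabel]
    refine Eq.to_iff (congrArg _ ?_)
    funext i
    fin_cases i <;> rfl
  simp only [h]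
  simp only [fixFormula, Formula.Realize, BoundedFormula.realize_ex, BoundedFormula.realize_inf,
    BoundedFormula.realize_bdEqual, fixEqns, Set.mem_insert_iff, Set.mem_singleton_iff,
    forall_eq_or_imp, forall_eq, Eqn.Holds]
  refine exists_congr fun x => ?_
  rw [show Fin.snoc default x = ![x] by funext i; fin_cases i; rfl]

/-- The formula `z ≤ (e ∧ y)^k`. -/
def chainFormula (k : ℕ) : flLang.Formula (Fin 2) :=
  Term.equal (chainEqn (0 : Fin 2) 1 k).1 (chainEqn (0 : Fin 2) 1 k).2

theorem realize_chainFormula {A : Type u} [flLang.Structure A] {v : Fin 2 → A} {k : ℕ} :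
    (chainFormula k).Realize v ↔ (chainEqn (0 : Fin 2) 1 k).Holds v :=
  Formula.realize_equal

include hFL hV hfix hpot

/-- Already a model companion is impossible; the completeness clause plays no role. -/
theorem not_hasModelCompletion : ¬ HasModelCompletion.{u} (theoryOf V) := by
  rintro ⟨T, ⟨hTV, hVT, hel⟩, -⟩
  have hne : ∀ A ∈ V, Nonempty A := fun A hA => by
    obtain ⟨A, _, rfl⟩ := exists_flAlg_of_mem_flVariety (hFL hA)
    exact ⟨(1 : A)⟩
  have hTV' : ∀ A ∈ V, ∃ N : T.ModelType.{0, 0, u}, Nonempty (A ↪[flLang] N) := fun A hA => by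
    have := hne A hA
    have : A ⊨ theoryOf V := ⟨fun φ hφ => hφ A hA⟩
    exact hTV (Theory.ModelType.of (theoryOf V) A)
  have hVT' : ∀ N : T.ModelType.{0, 0, u}, ∃ A ∈ V, Nonempty (N ↪[flLang] A) := fun N => by
    obtain ⟨M, hM⟩ := hVT N
    exact ⟨⟨M, inferInstance⟩, hV.mem_of_models hne ⟨M, inferInstance⟩ M.is_model, hM⟩
  have chain_of_fix : ∀ (N : T.ModelType.{0, 0, u}) (v : Fin 2 → N), fixFormula.Realize v →
      ∀ k, (chainEqn (0 : Fin 2) 1 k).Holds v := by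
    intro N v hv k
    obtain ⟨x, hx⟩ := realize_fixFormula.1 hv
    obtain ⟨A, hA, ⟨f⟩⟩ := hVT' N
    have h1 := entails_chainEqn hFL (0 : Fin 3) 1 2 k A hA (f ∘ ![x, v 0, v 1]) fun δ hδ =>
      (Eqn.holds_comp_iff (A := N) (B := A) f).2 (hx δ hδ)
    have h2 := (Eqn.holds_comp_iff (A := N) (B := A) f).1 h1
    rw [show chainEqn (1 : Fin 3) 2 k = (chainEqn (0 : Fin 2) 1 k).relabel ![1, 2] by
      rw [relabel_chainEqn]; rfl, Eqn.holds_relabel] at h2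
    convert h2 using 1
    funext i
    fin_cases i <;> rfl
  have fix_of_chain : ∀ (N : T.ModelType.{0, 0, u}) (v : Fin 2 → N),
      (∀ k, (chainEqn (0 : Fin 2) 1 k).Holds v) → fixFormula.Realize v := by
    intro N v hv
    obtain ⟨A, hA, ⟨f⟩⟩ := hVT' N
    obtain ⟨B, hB, g, x, hx⟩ := hfix A hA (f (v 0)) (f (v 1)) fun k => by
      have := (Eqn.holds_comp_iff (A := N) (B := A) f).2 (hv k)
      convert this using 1
      funext i
      fin_cases i <;> rfl
    obtain ⟨N', ⟨h⟩⟩ := hTV' B hB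
    -- The extension `N → A → B → N'` leads back to a model of `T`, hence is elementary, and the
    -- existence of the fixpoint descends to `N`.
    rw [← hel N N' ((h.comp g).comp f) 2 fixFormula v, realize_fixFormula]
    refine ⟨h x, fun δ hδ => ?_⟩
    have := (Eqn.holds_comp_iff (A := B) (B := N') h).2 (hx δ hδ)
    convert this using 1
    funext i
    fin_cases i <;> rfl
  -- Two constants satisfy the whole chain but have no fixpoint. Finite parts are satisfiable
  -- because the inequality for `n` does not imply that for `n + 1`, yet `fix_of_chain` excludes a
  -- model.
  let T' : flLang[[Fin 2]].Theory := (flLang.lhomWithConstants (Fin 2)).onTheory T ∪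
    (Set.range (fun k => Formula.equivSentence (chainFormula k)) ∪
      {Formula.equivSentence fixFormula.not})
  have hsat : T'.IsSatisfiable := by
    rw [Theory.isSatisfiable_iff_isFinitelySatisfiable]
    intro T₀ hT₀
    obtain ⟨n, hn⟩ : ∃ n : ℕ, ∀ φ ∈ T₀,
        φ ∈ Set.range (fun k => Formula.equivSentence (chainFormula k)) →
        ∃ k ≤ n, Formula.equivSentence (chainFormula k) = φ := by
      have : ∀ φ : flLang[[Fin 2]].Sentence, ∃ m : ℕ,
          φ ∈ Set.range (fun k => Formula.equivSentence (chainFormula k)) →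
          Formula.equivSentence (chainFormula m) = φ := fun φ => by
        by_cases h : φ ∈ Set.range (fun k => Formula.equivSentence (chainFormula k))
        · exact h.imp fun _ hm _ => hm
        · exact ⟨0, fun h' => absurd h' h⟩
      choose m hm using this
      exact ⟨T₀.sup m, fun φ hφ hr => ⟨m φ, Finset.le_sup hφ, hm φ hr⟩⟩
    have hnot := not_entails_succ hFL hpot n
    simp only [Entails, Set.mem_singleton_iff, forall_eq, not_forall] at hnot
    obtain ⟨A, hA, v, hv, hv'⟩ := hnot
    obtain ⟨N, ⟨f⟩⟩ := hTV' A hA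
    let : (constantsOn (Fin 2)).Structure N := constantsOn.structure (f ∘ v)
    have hreal : ∀ φ : flLang.Formula (Fin 2),
        N ⊨ (Formula.equivSentence φ) ↔ φ.Realize (f ∘ v) := fun φ =>
      Formula.realize_equivSentence N φ
    have : N ⊨ (T₀ : flLang[[Fin 2]].Theory) := by
      refine ⟨fun φ hφ => ?_⟩
      rcases hT₀ hφ with hφ' | hφ' | rfl
      · have : N ⊨ (flLang.lhomWithConstants (Fin 2)).onTheory T :=
          (LHom.onTheory_model _ _).2 inferInstance
        exact this.realize_of_mem _ hφ'
      · obtain ⟨k, hk, rfl⟩ := hn φ hφ hφ'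
        rw [hreal, realize_chainFormula, Eqn.holds_comp_iff (A := A) (B := N) f]
        obtain ⟨A, _, rfl⟩ := exists_flAlg_of_mem_flVariety (hFL hA)
        exact holds_chainEqn_iff.2
          ((holds_chainEqn_iff.1 hv).trans (unitMeet_pow_anti _ hk))
      · rw [hreal, Formula.realize_not]
        exact fun h => hv' ((Eqn.holds_comp_iff (A := A) (B := N) f).1 (chain_of_fix N _ h _))
    exact Theory.Model.isSatisfiable N
  obtain ⟨M₀⟩ := hsat
  let M : T'.ModelType.{0, 0, u} := M₀.ulift
  let := (flLang.lhomWithConstants (Fin 2)).reduct M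
  have hM : M ⊨ T' := M.is_model
  have : M ⊨ T := (LHom.onTheory_model (flLang.lhomWithConstants (Fin 2)) _).1
    (hM.mono Set.subset_union_left)
  let N := Theory.ModelType.of T M
  have hreal : ∀ φ : flLang.Formula (Fin 2), Formula.equivSentence φ ∈ T' →
      φ.Realize (fun a => ((flLang.con a : M) : N)) := fun φ hφ =>
    (Formula.realize_equivSentence M φ).1 (hM.realize_of_mem _ hφ)
  refine (Formula.realize_not.1 (hreal fixFormula.not (.inr (.inr rfl))))
    (fix_of_chain N _ fun k => realize_chainFormula.1 (hreal _ (.inr (.inl ⟨k, rfl⟩))))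

end Fixpoint

/-! ## Canonical extensions -/

section CanonicalExtension

section Poset

variable {P D : Type u} [CompleteLattice D] {j : P → D}

theorem isClosedElt_map (a : P) : IsClosedElt j (j a) := ⟨{a}, by simp, by simp⟩

theorem isOpenElt_map (a : P) : IsOpenElt j (j a) := ⟨{a}, by simp, by simp⟩

theorem mem_of_mem_nbhds {a : P} {N : Set P} (h : N ∈ nbhds j (j a)) : a ∈ N := by
  obtain ⟨p, q, -, -, hp, hq, rfl⟩ := h
  exact ⟨hp, hq⟩

variable [PartialOrder P]

theorem IsCompletion.injective (hj : IsCompletion j) : Function.Injective j := fun _ _ h =>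
  le_antisymm ((hj.le_iff _ _).1 h.le) ((hj.le_iff _ _).1 h.ge)

/-- Elements of `P` are both closed and open, so they have a least neighbourhood; this makes the
`σ`- and `π`-extensions restrict to the original operation. -/
theorem IsCompletion.singleton_mem_nbhds (hj : IsCompletion j) (a : P) :
    {a} ∈ nbhds j (j a) := by
  refine ⟨j a, j a, isClosedElt_map a, isOpenElt_map a, le_rfl, le_rfl, ?_⟩
  ext b
  simp only [Set.mem_singleton_iff, Set.mem_ofPred_eq, hj.le_iff]
  exact ⟨fun h => ⟨h.ge, h.le⟩, fun h => le_antisymm h.2 h.1⟩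

theorem IsCompletion.sigmaExt_map (hj : IsCompletion j) (f : P → P → P) (a b : P) :
    sigmaExt j f (j a) (j b) = j (f a b) := by
  refine le_antisymm (sSup_le ?_) (le_sSup ?_)
  · rintro _ ⟨M, hM, N, hN, rfl⟩
    exact sInf_le ⟨a, mem_of_mem_nbhds hM, b, mem_of_mem_nbhds hN, rfl⟩
  · exact ⟨{a}, hj.singleton_mem_nbhds a, {b}, hj.singleton_mem_nbhds b, by simp⟩

theorem IsCompletion.piExt_map (hj : IsCompletion j) (f : P → P → P) (a b : P) :
    piExt j f (j a) (j b) = j (f a b) := by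
  refine le_antisymm (sInf_le ?_) (le_sInf ?_)
  · exact ⟨{a}, hj.singleton_mem_nbhds a, {b}, hj.singleton_mem_nbhds b, by simp⟩
  · rintro _ ⟨M, hM, N, hN, rfl⟩
    exact le_sSup ⟨a, mem_of_mem_nbhds hM, b, mem_of_mem_nbhds hN, rfl⟩

/-- Compactness for the meet of a descending sequence below an open element. -/
theorem IsCanonicalExtension.exists_le_of_iInf_le (hj : IsCanonicalExtension j) {a : ℕ → P}
    (ha : Antitone a) {q : D} (hq : IsOpenElt j q) (h : ⨅ k, j (a k) ≤ q) :
    ∃ k, j (a k) ≤ q := by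
  obtain ⟨S₀, hS₀, T₀, hT₀, hfin, -, hle⟩ := hj.compact (Set.range fun k => j (a k)) {q}
    (Set.range_nonempty _) (Set.singleton_nonempty q)
    (by rintro _ ⟨k, rfl⟩; exact isClosedElt_map _) (by rintro _ rfl; exact hq)
    (by rwa [sInf_range, sSup_singleton])
  obtain ⟨N, -, hN, rfl⟩ := (Set.exists_subset_image_finite_and (f := fun k => j (a k))
    (s := Set.univ) (p := (· = S₀))).1 ⟨S₀, by simpa using hS₀, hfin, rfl⟩
  obtain ⟨n, hn⟩ := hN.bddAbove
  refine ⟨n, le_trans (le_sInf ?_) (hle.trans (sSup_le fun t ht => (hT₀ ht).le))⟩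
  rintro _ ⟨k, hk, rfl⟩
  exact (hj.le_iff _ _).2 (ha (hn hk))

end Poset

variable {A D : Type u} [FLAlgebra A] [CompleteLattice D] {j : A → D}

theorem IsCompletion.map_inf (hj : IsCompletion j) (a b : A) : j (a ⊓ b) = j a ⊓ j b := by
  have := hj.map_isGLB {a, b} (a ⊓ b) (Set.toFinite _) isGLB_pair
  rw [Set.image_pair] at this
  exact this.unique isGLB_pair

theorem IsCompletion.map_sup (hj : IsCompletion j) (a b : A) : j (a ⊔ b) = j a ⊔ j b := by
  have := hj.map_isLUB {a, b} (a ⊔ b) (Set.toFinite _) isLUB_pair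
  rw [Set.image_pair] at this
  exact this.unique isLUB_pair

/-- The embedding of an FL-algebra into its canonical extension. -/
def IsCompletion.embedding (hj : IsCompletion j) :
    flAlg A ↪[flLang] canonicalAlg ⟨A, inferInstance⟩ j where
  toFun := j
  inj' := hj.injective
  map_fun' f v := by
    cases f
    · exact hj.map_inf _ _
    · exact hj.map_sup _ _
    · exact (hj.sigmaExt_map _ _ _).symm
    · exact (hj.piExt_map _ _ _).symm
    · exact (hj.piExt_map _ _ _).symm
    · rfl
    · rfl
  map_rel' r _ := r.elim

/-- The meet of the powers of a negative element is a fixpoint of the multiplication by it. -/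
theorem IsCanonicalExtension.sigmaExt_iInf_pow (hj : IsCanonicalExtension j) (a : A)
    (ha : a ≤ 1) :
    sigmaExt j (fun a b => a * b) (⨅ k : ℕ, j (a ^ k)) (j a) = ⨅ k : ℕ, j (a ^ k) := by
  have hanti : Antitone fun k : ℕ => a ^ k := antitone_nat_of_succ_le fun k => by
    rw [pow_succ]
    exact (mul_le_mul_right ha _).trans (mul_one _).le
  -- For the lower bound, the meet of the powers is closed and serves as the lower end of its own
  -- neighbourhood, with `e` as upper end.
  refine le_antisymm (sSup_le ?_) (le_sSup_of_le
    ⟨{b | (⨅ k : ℕ, j (a ^ k)) ≤ j b ∧ j b ≤ j 1}, ?_, {a}, hj.singleton_mem_nbhds a, rfl⟩ ?_)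
  · rintro _ ⟨M, ⟨p, q, -, hq, hp, hxq, rfl⟩, N, hN, rfl⟩
    -- By compactness every neighbourhood contains all sufficiently high powers, so the meets of
    -- products lie below each `a ^ k`.
    obtain ⟨m, hm⟩ := hj.exists_le_of_iInf_le hanti hq hxq
    refine le_iInf fun k => ?_
    have hk : j (a ^ (k + m) * a) ≤ j (a ^ k) :=
      (hj.le_iff _ _).2 (by rw [← pow_succ]; exact hanti (by omega))
    refine le_trans (sInf_le ⟨a ^ (k + m), ⟨hp.trans (iInf_le _ _), ?_⟩, a,
      mem_of_mem_nbhds hN, rfl⟩) hk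
    exact ((hj.le_iff _ _).2 (hanti (by omega))).trans hm
  · exact ⟨_, _, ⟨Set.range fun k : ℕ => a ^ k, Set.range_nonempty _, by
      rw [← Set.range_comp, sInf_range]; rfl⟩, isOpenElt_map 1, le_rfl,
      (iInf_le _ 0).trans (by simp), rfl⟩
  · refine le_sInf ?_
    rintro _ ⟨b, ⟨hb, -⟩, _, rfl, rfl⟩
    -- Compactness again: `b` lies above some `a ^ k`, hence `ba` above `a ^ (k + 1)`.
    obtain ⟨k, hk⟩ := hj.exists_le_of_iInf_le hanti (isOpenElt_map b) hb
    refine (iInf_le _ (k + 1)).trans ((hj.le_iff _ _).2 ?_)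
    rw [pow_succ]
    exact mul_le_mul_left ((hj.le_iff _ _).1 hk) _

theorem IsCanonicalExtension.exists_holds_fixEqns (hj : IsCanonicalExtension j) (y z : A)
    (hz : ∀ k, z ≤ (1 ⊓ y) ^ k) :
    ∃ x : canonicalAlg ⟨A, inferInstance⟩ j,
      ∀ δ ∈ fixEqns (0 : Fin 3) 1 2, δ.Holds (A := canonicalAlg ⟨A, inferInstance⟩ j)
        ![x, j y, j z] := by
  let x : D := ⨅ k : ℕ, j ((1 ⊓ y) ^ k)
  have h1 : j z ⊓ x = j z := inf_eq_left.2 (le_iInf fun k => (hj.le_iff _ _).2 (hz k))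
  have h2 : x ⊓ j 1 = x := inf_eq_left.2 ((iInf_le _ 0).trans (by simp))
  have h3 : x = sigmaExt j (fun a b => a * b) x (j 1 ⊓ j y) := by
    rw [← hj.map_inf, hj.sigmaExt_iInf_pow _ inf_le_left]
  refine ⟨x, ?_⟩
  simp only [fixEqns, Set.mem_insert_iff, Set.mem_singleton_iff, forall_eq_or_imp, forall_eq]
  exact ⟨h1, h2, h3⟩

end CanonicalExtension

/-! ### Fixpoints in products of canonical extensions -/

theorem isp_subset {L : FirstOrder.Language.{0, 0}} {C V : Set (Bundled.{u} L.Structure)}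
    (hV : IsVariety V) (h : C ⊆ V) : ISP C ⊆ V := by
  rintro A ⟨I, B, hB, ⟨f⟩⟩
  refine hV.mem_of_embedding (B := ⟨∀ i, B i, inferInstance⟩) ?_ f
  obtain ⟨E, hE⟩ := hV
  exact (hE _).2 fun ε hε v => (Eqn.holds_pi_iff _).2 fun i => (hE _).1 (h (hB i)) ε hε _

theorem toAlg_image_subset (C : Set (Bundled.{u} FLAlgebra)) : toAlg '' C ⊆ flVariety ∅ := by
  rintro _ ⟨A, -, rfl⟩
  exact ⟨⟨A, rfl⟩, by simp⟩

theorem pi_mem_isp {L : FirstOrder.Language.{0, 0}} {C : Set (Bundled.{u} L.Structure)}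
    {I : Type u} (B : I → Bundled.{u} L.Structure) (hB : ∀ i, B i ∈ C) :
    (⟨∀ i, B i, inferInstance⟩ : Bundled.{u} L.Structure) ∈ ISP C :=
  ⟨I, B, hB, ⟨Embedding.refl L _⟩⟩

/-- Embeddings of the factors induce an embedding of the products. -/
def piEmbedding {L : FirstOrder.Language.{0, 0}} {I : Type u} {B B' : I → Type u}
    [∀ i, L.Structure (B i)] [∀ i, L.Structure (B' i)] (f : ∀ i, B i ↪[L] B' i) :
    (∀ i, B i) ↪[L] (∀ i, B' i) where
  toFun x i := f i (x i)
  inj' _ _ h := funext fun i => (f i).injective (congrFun h i)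
  map_fun' g v := funext fun i => (f i).map_fun g fun k => v k i
  map_rel' r v := forall_congr' fun i => (f i).map_rel r fun k => v k i

theorem fixpointExtension_isp {C : Set (Bundled.{u} FLAlgebra)}
    (hC : ClosedUnderCanonicalExtensions C) : FixpointExtension (ISP (toAlg '' C)) := by
  rintro A ⟨I, B, hB, ⟨f⟩⟩ y z hyz
  have key : ∀ i, ∃ E ∈ toAlg '' C, ∃ (g : B i ↪[flLang] E) (x : E),
      ∀ δ ∈ fixEqns (0 : Fin 3) 1 2, δ.Holds ![x, g (f y i), g (f z i)] := by
    intro i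
    obtain ⟨B', hB', hBi⟩ := hB i
    obtain ⟨D, _, j, hj, E, hE, ⟨e⟩⟩ := hC B' hB'
    let := B'.str
    have hchain : ∀ k, (chainEqn (0 : Fin 2) 1 k).Holds ![f y i, f z i] := fun k => by
      have := (Eqn.holds_pi_iff _).1 ((Eqn.holds_comp_iff (B := ∀ i, B i) f).2 (hyz k)) i
      convert this using 1
      funext l
      fin_cases l <;> rfl
    generalize f y i = y' at *
    generalize f z i = z' at *
    generalize B i = Bi at *
    subst hBi
    obtain ⟨x, hx⟩ := hj.exists_holds_fixEqns (A := B') y' z' fun k =>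
      holds_chainEqn_iff (A := B').1 (hchain k)
    refine ⟨_, ⟨E, hE, rfl⟩, e.symm.toEmbedding.comp (IsCompletion.embedding (A := B')
      hj.toIsCompletion), e.symm x, fun δ hδ => ?_⟩
    have := (Eqn.holds_comp_iff (A := canonicalAlg B' j) (B := toAlg E)
      e.symm.toEmbedding).2 (hx δ hδ)
    convert this using 1
    funext l
    fin_cases l <;> rfl
  choose E hE g x hx using key
  refine ⟨_, pi_mem_isp E hE, (piEmbedding g).comp f, x, fun δ hδ => ?_⟩
  refine (Eqn.holds_pi_iff _).2 fun i => ?_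
  convert hx i δ hδ using 1
  funext l
  fin_cases l <;> rfl

/-! ## Reduced powers -/

section ReducedPower

open Filter

variable {A : Type u} [FLAlgebra A] {l : Filter ℕ}

instance : FLAlgebra (Germ l A) :=
  { (inferInstance : Lattice (Germ l A)), (inferInstance : Monoid (Germ l A)) with
    ldiv := Germ.map₂ FLAlgebra.ldiv
    rdiv := Germ.map₂ FLAlgebra.rdiv
    falsum := (FLAlgebra.falsum : A)
    le_ldiv_iff := fun a b c => Germ.inductionOn₃ a b c fun _ _ _ =>
      eventually_congr (.of_forall fun _ => FLAlgebra.le_ldiv_iff _ _ _)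
    le_rdiv_iff := fun a b c => Germ.inductionOn₃ a b c fun _ _ _ =>
      eventually_congr (.of_forall fun _ => FLAlgebra.le_rdiv_iff _ _ _) }

theorem funMap_germ {n : ℕ} (f : flLang.Functions n) (v : Fin n → ℕ → A) :
    Structure.funMap f (fun i => (v i : Germ l A)) =
      ((fun m => Structure.funMap f fun i => v i m : ℕ → A) : Germ l A) := by
  cases f <;> rfl

theorem realize_germ {α : Type} (t : flLang.Term α) (v : α → ℕ → A) :
    t.realize (fun a => (v a : Germ l A)) =
      ((fun n => t.realize fun a => v a n : ℕ → A) : Germ l A) := by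
  induction t with
  | var => rfl
  | func f ts ih =>
    simp only [Term.realize, ih]
    exact funMap_germ f _

theorem holds_germ {α : Type} {ε : Eqn flLang α} (h : ∀ v : α → A, ε.Holds v)
    (v : α → Germ l A) : ε.Holds v := by
  have hv : ∀ a, ∃ w : ℕ → A, (w : Germ l A) = v a := fun a => Quot.exists_rep (v a)
  choose w hw using hv
  obtain rfl : (fun a => (w a : Germ l A)) = v := funext hw
  unfold Eqn.Holds
  rw [realize_germ, realize_germ]
  exact congrArg _ (funext fun n => h _)

/-- The diagonal embedding into a reduced power. -/
def germEmbedding [l.NeBot] : A ↪[flLang] Germ l A where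
  toFun a := (a : Germ l A)
  inj' _ _ h := Germ.const_inj.1 h
  map_fun' f v := (funMap_germ f fun i _ => v i).symm
  map_rel' r _ := r.elim

/-- Reduced powers over the filter `atTop` of `ℕ` are saturated with respect to descending
sequences of powers. -/
theorem exists_pow_le_germ {a : A} (ha : a ≤ 1) {c : Germ (atTop : Filter ℕ) A}
    (h : ∀ w : Germ (atTop : Filter ℕ) A, (∀ k : ℕ, w ≤ (a : Germ atTop A) ^ k) →
      w * (a : Germ atTop A) ≤ c) :
    ∃ k : ℕ, (a : Germ (atTop : Filter ℕ) A) ^ k ≤ c := by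
  have hanti : Antitone fun k : ℕ => a ^ k := antitone_nat_of_succ_le fun k => by
    rw [pow_succ]
    exact (mul_le_mul_right ha _).trans (mul_one _).le
  by_contra! hc
  revert h hc
  refine Germ.inductionOn c fun c h hc => ?_
  have hfreq : ∀ k : ℕ, ∃ᶠ n in atTop, ¬ a ^ (k + 1) ≤ c n := fun k hk =>
    hc (k + 1) (hk.mono fun n hn => not_not.1 hn)
  obtain ⟨φ, hφ, hφc⟩ := extraction_forall_of_frequently hfreq
  -- Diagonal witness `w n = a ^ e n`: `e` tends to infinity, so `w` is below every power, but `e (φ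
  -- k) = k` makes `w * a` equal to `a ^ (k + 1)` at `φ k`, where `c` is not above it.
  let e : ℕ → ℕ := Function.extend φ id id
  have heφ : ∀ k, e (φ k) = k := fun k => hφ.injective.extend_apply _ _ _
  have he : ∀ m, ∀ᶠ n in atTop, m ≤ e n := fun m => by
    filter_upwards [eventually_ge_atTop (φ m)] with n hn
    by_cases hex : ∃ k, φ k = n
    · obtain ⟨k, rfl⟩ := hex
      rw [heφ]
      exact hφ.le_iff_le.1 hn
    · simp only [e, Function.extend_apply' _ _ _ hex, id]
      exact (hφ.id_le m).trans hn
  have := h ((fun n => a ^ e n : ℕ → A) : Germ atTop A) fun k =>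
    (he k).mono fun n hn => hanti hn
  obtain ⟨k, hk⟩ := (hφ.tendsto_atTop.eventually this).exists
  refine hφc k ?_
  simpa only [heφ, pow_succ] using hk

end ReducedPower

/-! ## The Dedekind–MacNeille completion of an FL-algebra -/

/-- The sets that contain all lower bounds of their upper bounds. -/
@[ext]
structure Cut (A : Type u) [Preorder A] where
  /-- The set of elements of the cut. -/
  carrier : Set A
  closed : ∀ x, (∀ u ∈ upperBounds carrier, x ≤ u) → x ∈ carrier

namespace Cut

variable {A : Type u}

section Order

variable [PartialOrder A]

instance : SetLike (Cut A) A := ⟨carrier, fun _ _ h => Cut.ext h⟩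

instance : PartialOrder (Cut A) := .ofSetLike (Cut A) A

theorem mem_of_forall {X : Cut A} {x : A} (h : ∀ u, (∀ y ∈ X, y ≤ u) → x ≤ u) : x ∈ X :=
  X.closed x fun u hu => h u fun _ hy => hu hy

theorem mem_of_le {X : Cut A} {x y : A} (hy : y ∈ X) (h : x ≤ y) : x ∈ X :=
  mem_of_forall fun _ hu => h.trans (hu y hy)

/-- The cut generated by a set. -/
def closure (S : Set A) : Cut A where
  carrier := {x | ∀ u ∈ upperBounds S, x ≤ u}
  closed _ h u hu := h u fun _ hy => hy u hu

theorem closure_le_iff {S : Set A} {X : Cut A} : closure S ≤ X ↔ ∀ x ∈ S, x ∈ X :=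
  ⟨fun h _ hx => h fun _ hu => hu hx,
    fun h _ hx => mem_of_forall fun _ hu => hx _ fun y hy => hu y (h y hy)⟩

/-- The principal cut. -/
def principal (a : A) : Cut A where
  carrier := Set.Iic a
  closed _ h := h a fun _ hy => hy

@[simp] theorem mem_principal {a x : A} : x ∈ principal a ↔ x ≤ a := Iff.rfl

@[simp] theorem principal_le_iff {a : A} {X : Cut A} : principal a ≤ X ↔ a ∈ X :=
  ⟨fun h => h (mem_principal.2 le_rfl), fun h _ hx => mem_of_le h hx⟩

theorem principal_injective : Function.Injective (principal : A → Cut A) := fun _ _ h =>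
  le_antisymm (principal_le_iff.1 h.le) (principal_le_iff.1 h.ge)

end Order

variable [FLAlgebra A]

instance : Lattice (Cut A) where
  sup X Y := closure (X ∪ Y)
  inf X Y :=
    { carrier := X ∩ Y
      closed := fun _ h => ⟨mem_of_forall fun u hu => h u fun y hy => hu y hy.1,
        mem_of_forall fun u hu => h u fun y hy => hu y hy.2⟩ }
  le_sup_left _ _ := fun _ hx _ hu => hu (.inl hx)
  le_sup_right _ _ := fun _ hx _ hu => hu (.inr hx)
  sup_le _ _ _ h h' := closure_le_iff.2 fun _ hx => hx.elim (fun hx => h hx) fun hx => h' hx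
  inf_le_left _ _ := fun _ hx => hx.1
  inf_le_right _ _ := fun _ hx => hx.2
  le_inf _ _ _ h h' := fun _ hx => ⟨h hx, h' hx⟩

instance : Mul (Cut A) := ⟨fun X Y => closure {w | ∃ x ∈ X, ∃ y ∈ Y, w = x * y}⟩

instance : One (Cut A) := ⟨principal 1⟩

theorem mul_le_iff {X Y Z : Cut A} : X * Y ≤ Z ↔ ∀ x ∈ X, ∀ y ∈ Y, x * y ∈ Z :=
  closure_le_iff.trans
    ⟨fun h x hx y hy => h _ ⟨x, hx, y, hy, rfl⟩, by
      rintro h _ ⟨x, hx, y, hy, rfl⟩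
      exact h x hx y hy⟩

theorem one_le_iff {X : Cut A} : 1 ≤ X ↔ (1 : A) ∈ X := principal_le_iff

/-- The left residual of cuts. -/
def ldiv (X Z : Cut A) : Cut A where
  carrier := {b | ∀ a ∈ X, a * b ∈ Z}
  closed b h a ha := mem_of_forall fun u hu => by
    rw [← FLAlgebra.le_ldiv_iff]
    exact h _ fun b' hb' => (FLAlgebra.le_ldiv_iff _ _ _).2 (hu _ (hb' a ha))

/-- The right residual of cuts. -/
def rdiv (Z Y : Cut A) : Cut A where
  carrier := {a | ∀ b ∈ Y, a * b ∈ Z}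
  closed a h b hb := mem_of_forall fun u hu => by
    rw [← FLAlgebra.le_rdiv_iff]
    exact h _ fun a' ha' => (FLAlgebra.le_rdiv_iff _ _ _).2 (hu _ (ha' b hb))

theorem mem_ldiv {X Z : Cut A} {b : A} : b ∈ ldiv X Z ↔ ∀ a ∈ X, a * b ∈ Z := Iff.rfl

theorem mem_rdiv {Z Y : Cut A} {a : A} : a ∈ rdiv Z Y ↔ ∀ b ∈ Y, a * b ∈ Z := Iff.rfl

theorem le_ldiv_iff (X Y Z : Cut A) : Y ≤ ldiv X Z ↔ X * Y ≤ Z :=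
  Iff.symm <| mul_le_iff.trans
    ⟨fun h _ hy x hx => h x hx _ hy, fun h _ hx _ hy => h hy _ hx⟩

theorem le_rdiv_iff (X Y Z : Cut A) : X ≤ rdiv Z Y ↔ X * Y ≤ Z :=
  Iff.symm <| mul_le_iff.trans
    ⟨fun h _ hx y hy => h _ hx y hy, fun h _ hx y hy => h hx y hy⟩

/-- Products of cuts are closures; comparing the cuts above both sides and moving factors across by
residuation reduces the laws to those of elements. -/
instance : Monoid (Cut A) where
  mul_assoc X Y Z := eq_of_forall_ge_iff fun W => by
    rw [← le_rdiv_iff, mul_le_iff, ← le_ldiv_iff, mul_le_iff]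
    simp only [mem_rdiv, mem_ldiv, mul_assoc]
    exact ⟨fun h y hy z hz x hx => h x hx y hy z hz, fun h x hx y hy z hz => h y hy z hz x hx⟩
  one_mul X := eq_of_forall_ge_iff fun W => by
    rw [← le_rdiv_iff, one_le_iff, mem_rdiv]
    simp only [one_mul]
    rfl
  mul_one X := eq_of_forall_ge_iff fun W => by
    rw [← le_ldiv_iff, one_le_iff, mem_ldiv]
    simp only [mul_one]
    rfl

instance : FLAlgebra (Cut A) where
  ldiv := ldiv
  rdiv := rdiv
  falsum := principal FLAlgebra.falsum
  le_ldiv_iff := le_ldiv_iff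
  le_rdiv_iff := le_rdiv_iff

theorem principal_inf (a b : A) : principal (a ⊓ b) = principal a ⊓ principal b :=
  SetLike.ext fun _ => le_inf_iff

theorem principal_sup (a b : A) : principal (a ⊔ b) = principal a ⊔ principal b :=
  eq_of_forall_ge_iff fun W => by
    rw [sup_le_iff, principal_le_iff, principal_le_iff, principal_le_iff]
    exact ⟨fun h => ⟨mem_of_le h le_sup_left, mem_of_le h le_sup_right⟩,
      fun h => mem_of_forall fun u hu => sup_le (hu _ h.1) (hu _ h.2)⟩

theorem principal_mul (a b : A) : principal (a * b) = principal a * principal b :=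
  eq_of_forall_ge_iff fun W => by
    rw [principal_le_iff, mul_le_iff]
    exact ⟨fun h x hx y hy => mem_of_le h ((mul_le_mul_left hx _).trans (mul_le_mul_right hy _)),
      fun h => h a le_rfl b le_rfl⟩

theorem principal_ldiv (a b : A) :
    principal (FLAlgebra.ldiv a b) = ldiv (principal a) (principal b) :=
  SetLike.ext fun x => by
    rw [mem_principal, FLAlgebra.le_ldiv_iff, mem_ldiv]
    exact ⟨fun h y hy => (mul_le_mul_left hy _).trans h, fun h => h a le_rfl⟩

theorem principal_rdiv (a b : A) :
    principal (FLAlgebra.rdiv a b) = rdiv (principal a) (principal b) :=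
  SetLike.ext fun x => by
    rw [mem_principal, FLAlgebra.le_rdiv_iff, mem_rdiv]
    exact ⟨fun h y hy => (mul_le_mul_right hy _).trans h, fun h => h b le_rfl⟩

/-- The embedding of an FL-algebra into its Dedekind–MacNeille completion. -/
def embedding : A ↪[flLang] Cut A where
  toFun := principal
  inj' := principal_injective
  map_fun' f v := by
    cases f
    · exact principal_inf _ _
    · exact principal_sup _ _
    · exact principal_mul _ _
    · exact principal_ldiv _ _
    · exact principal_rdiv _ _
    · rfl
    · rfl
  map_rel' r _ := r.elim

/-- The axioms of the varieties of FL-algebras considered here are preserved by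
Dedekind–MacNeille completions. -/
theorem holds {ε : Eqn flLang ℕ} (hε : ε ∈ exchangeAx ∪ weakeningAx ∪ involutionAx)
    (h : ∀ v : ℕ → A, ε.Holds v) (v : ℕ → Cut A) : ε.Holds v := by
  rcases hε with (rfl | rfl | rfl) | rfl | rfl
  · have h' : ∀ x y : A, x * y = y * x := fun x y => h fun n => if n = 0 then x else y
    refine eq_of_forall_ge_iff fun W => ?_
    simp only [realize_mul, mul_le_iff]
    exact ⟨fun hW x hx y hy => h' y x ▸ hW y hy x hx, fun hW x hx y hy => h' y x ▸ hW y hy x hx⟩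
  · have h' : ∀ x : A, x ≤ 1 := fun x => (holds_leEqn _ _ _).1 (h fun _ => x)
    exact (holds_leEqn _ _ _).2 fun x _ => h' x
  · have h' : ∀ x : A, FLAlgebra.falsum ≤ x := fun x => (holds_leEqn _ _ _).1 (h fun _ => x)
    exact (holds_leEqn _ _ _).2 (principal_le_iff.2 (mem_of_forall fun u _ => h' u))
  · have h' : ∀ x : A, FLAlgebra.rdiv FLAlgebra.falsum (FLAlgebra.ldiv x FLAlgebra.falsum) = x :=
      fun x => h fun _ => x
    refine le_antisymm (fun c hc => mem_of_forall fun d hd => ?_)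
      ((FLAlgebra.le_rdiv_iff _ _ _).2 (mul_ldiv_le _ _))
    -- Since `d = 0/(d\0)`, it suffices that `c(d\0) ≤ 0`, which holds because `d\0` belongs to the
    -- residual of the cut: `a(d\0) ≤ d(d\0) ≤ 0` for each `a` in it.
    rw [← h' d, FLAlgebra.le_rdiv_iff]
    exact hc _ fun a ha => (mul_le_mul_left (hd a ha) _).trans (mul_ldiv_le _ _)
  · have h' : ∀ x : A, FLAlgebra.ldiv (FLAlgebra.rdiv FLAlgebra.falsum x) FLAlgebra.falsum = x :=
      fun x => h fun _ => x
    refine le_antisymm (fun c hc => mem_of_forall fun d hd => ?_)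
      ((FLAlgebra.le_ldiv_iff _ _ _).2 (rdiv_mul_le _ _))
    rw [← h' d, FLAlgebra.le_ldiv_iff]
    exact hc _ fun a ha => (mul_le_mul_right (hd a ha) _).trans (rdiv_mul_le _ _)

/-- The lower bounds of the powers of an element. -/
def powers (a : A) : Cut A where
  carrier := {w | ∀ k : ℕ, w ≤ a ^ k}
  closed _ h k := h _ fun _ hy => hy k

/-- A cut is determined by its upper bounds, and the hypothesis puts every upper bound of the
products `w * a` above some power of `a`. -/
theorem powers_eq_mul {a : A} (ha : a ≤ 1)
    (h : ∀ c, (∀ w, (∀ k : ℕ, w ≤ a ^ k) → w * a ≤ c) → ∃ k : ℕ, a ^ k ≤ c) :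
    powers a = powers a * principal a := by
  refine le_antisymm (fun w hw => mem_of_forall fun c hc => ?_) (mul_le_iff.2 fun w hw b hb => ?_)
  · obtain ⟨k, hk⟩ := h c fun w' hw' => hc _ fun u hu => hu ⟨w', hw', a, le_rfl, rfl⟩
    exact (hw k).trans hk
  · exact mem_of_le hw ((mul_le_mul_right (hb.trans ha) w).trans (mul_one w).le)

end Cut

theorem fixpointExtension_flVariety {E : Set (Eqn flLang ℕ)}
    (hE : E ⊆ exchangeAx ∪ weakeningAx ∪ involutionAx) :
    FixpointExtension (flVariety.{u} E) := by
  intro A hA y z hyz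
  obtain ⟨A, _, rfl⟩ := exists_flAlg_of_mem_flVariety hA
  let G := Filter.Germ (Filter.atTop : Filter ℕ) A
  let f : A ↪[flLang] Cut G := Cut.embedding.comp germEmbedding
  let a : A := 1 ⊓ y
  have hone : Cut.principal (1 : G) = 1 := rfl
  have ha : (a : G) ≤ 1 := Filter.Germ.const_le (inf_le_left : a ≤ 1)
  have hfa : (1 : Cut G) ⊓ f y = Cut.principal (a : G) := (Cut.principal_inf (1 : G) (y : G)).symm
  refine ⟨flAlg (Cut G), flAlg_mem_flVariety_iff.2 fun ε hε => Cut.holds (hE hε)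
    (holds_germ (flAlg_mem_flVariety_iff.1 hA ε hε)), f, Cut.powers (a : G),
    holds_fixEqns_iff.2 ⟨?_, ?_, ?_⟩⟩
  · refine Cut.principal_le_iff.2 fun k => ?_
    exact Filter.Germ.const_le (holds_chainEqn_iff.1 (hyz k))
  · intro w hw
    exact (hw 0).trans (pow_zero _).le
  · change Cut.powers (a : G) = Cut.powers (a : G) * (1 ⊓ f y)
    rw [hfa]
    exact Cut.powers_eq_mul ha fun c hc => exists_pow_le_germ (inf_le_left : a ≤ 1) hc

/-! ## Finite Łukasiewicz chains -/

/-- The Łukasiewicz chain with `N + 1` elements. -/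
@[ext]
structure Luk (N : ℕ) : Type u where
  /-- The rank of an element. -/
  val : Fin (N + 1)

namespace Luk

variable {N : ℕ}

instance : LinearOrder (Luk.{u} N) :=
  LinearOrder.lift' val fun _ _ h => Luk.ext h

theorem le_def {x y : Luk.{u} N} : x ≤ y ↔ (x.val : ℕ) ≤ y.val := Iff.rfl

theorem eq_iff {x y : Luk.{u} N} : x = y ↔ (x.val : ℕ) = y.val := by
  rw [Luk.ext_iff, Fin.ext_iff]

theorem val_le (x : Luk.{u} N) : (x.val : ℕ) ≤ N := Fin.is_le _

instance : Monoid (Luk.{u} N) where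
  mul x y := ⟨⟨x.val + y.val - N, by have := x.val_le; have := y.val_le; omega⟩⟩
  one := ⟨Fin.last N⟩
  mul_assoc x y z := by
    have := x.val_le; have := y.val_le; have := z.val_le
    refine eq_iff.2 ?_
    change (x.val + y.val - N : ℕ) + z.val - N = (x.val : ℕ) + (y.val + z.val - N) - N
    omega
  one_mul x := by
    have := x.val_le
    refine eq_iff.2 ?_
    change N + (x.val : ℕ) - N = x.val
    omega
  mul_one x := by
    have := x.val_le
    refine eq_iff.2 ?_
    change (x.val : ℕ) + N - N = x.val
    omega

theorem val_mul (x y : Luk.{u} N) : ((x * y).val : ℕ) = x.val + y.val - N := rfl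

theorem val_one : ((1 : Luk.{u} N).val : ℕ) = N := rfl

instance : FLAlgebra (Luk.{u} N) where
  ldiv x z := ⟨⟨min N (N - x.val + z.val), by omega⟩⟩
  rdiv z x := ⟨⟨min N (N - x.val + z.val), by omega⟩⟩
  falsum := ⟨0⟩
  le_ldiv_iff x y z := by
    have := x.val_le; have := y.val_le; have := z.val_le
    rw [le_def, le_def, val_mul]
    change (y.val : ℕ) ≤ min N (N - x.val + z.val) ↔ _
    omega
  le_rdiv_iff x y z := by
    have := x.val_le; have := y.val_le; have := z.val_le
    rw [le_def, le_def, val_mul]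
    change (x.val : ℕ) ≤ min N (N - y.val + z.val) ↔ _
    omega

theorem holds {ε : Eqn flLang ℕ} (hε : ε ∈ exchangeAx ∪ weakeningAx ∪ involutionAx)
    (v : ℕ → Luk.{u} N) : ε.Holds v := by
  have := (v 0).val_le
  rcases hε with (rfl | rfl | rfl) | rfl | rfl
  · refine eq_iff.2 ?_
    simp only [realize_mul, realize_tVar, val_mul, add_comm]
  · exact (holds_leEqn _ _ _).2 (v 0).val_le
  · exact (holds_leEqn _ _ _).2 (Nat.zero_le _)
  · refine eq_iff.2 ?_
    change min N (N - min N (N - (v 0).val + 0) + 0) = ((v 0).val : ℕ)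
    omega
  · refine eq_iff.2 ?_
    change min N (N - min N (N - (v 0).val + 0) + 0) = ((v 0).val : ℕ)
    omega

theorem val_pow_pred (x : Luk.{u} N) (hx : (x.val : ℕ) = N - 1) (k : ℕ) :
    ((x ^ k).val : ℕ) = N - k := by
  have := x.val_le
  induction k with
  | zero => simpa using val_one
  | succ k ih =>
    rw [pow_succ, val_mul, ih, hx]
    omega

end Luk

theorem not_satisfies_potencyEqn {E : Set (Eqn flLang ℕ)}
    (hE : E ⊆ exchangeAx ∪ weakeningAx ∪ involutionAx) (n : ℕ) :
    ¬ Satisfies (flVariety.{u} E) (potencyEqn n) := by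
  intro h
  -- The coatom: each power lowers the rank by one, so `x ^ n` has rank `1` and `x ^ (n + 1)` has
  -- rank `0`.
  let x : Luk.{u} (n + 1) := ⟨⟨n, by omega⟩⟩
  have := h (flAlg (Luk.{u} (n + 1)))
    (flAlg_mem_flVariety_iff.2 fun ε hε => Luk.holds (hE hε)) fun _ => x
  simp only [Eqn.Holds, potencyEqn, realize_tPow, realize_meet, realize_tOne, realize_tVar] at this
  rw [inf_eq_right.2 (show x ≤ 1 from Luk.val_le x), Luk.eq_iff, Luk.val_pow_pred x rfl,
    Luk.val_pow_pred x rfl] at this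
  omega

end UnifInterp

open UnifInterp
theorem corollary5p11 :
    -- the general result, for `V = ISP(C)`
    (∀ (C : Set (Bundled.{u} FLAlgebra)) (V : Set (Bundled.{u} flLang.Structure)),
      V = ISP (toAlg '' C) → IsVariety V → ClosedUnderCanonicalExtensions C →
      (∀ n : ℕ, ¬ Satisfies V (potencyEqn n)) →
      ¬ Coherent V ∧ ¬ UniformDeductiveInterpolation V ∧
        ¬ HasModelCompletion.{u} (theoryOf V)) ∧
    -- `FL`, `FL_e`, `FL_w`, `FL_ew`, and their involutive versions (the involutive version of
    -- `FL_e` being `MALL`)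
    (∀ E ∈ ({∅, exchangeAx, weakeningAx, exchangeAx ∪ weakeningAx} : Set (Set (Eqn flLang ℕ))),
      ∀ V : Set (Bundled.{u} flLang.Structure),
      V = flVariety E ∨ V = flVariety (E ∪ involutionAx) →
      ¬ Coherent V ∧ ¬ UniformDeductiveInterpolation V ∧
        ¬ HasModelCompletion.{u} (theoryOf V)) := by
  constructor
  · rintro C V rfl hV hC hpot
    have hFL := isp_subset (isVariety_flVariety ∅) (toAlg_image_subset C)
    have hfix := fixpointExtension_isp hC
    exact ⟨not_coherent hFL hV hfix hpot, not_uniformDeductiveInterpolation hFL hV hfix hpot,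
      not_hasModelCompletion hFL hV hfix hpot⟩
  -- All eight axiom sets lie in this union, and both the completion argument and the Łukasiewicz
  -- chains treat its axioms one at a time.
  · have key : ∀ E ⊆ exchangeAx ∪ weakeningAx ∪ involutionAx,
        ¬ Coherent (flVariety.{u} E) ∧ ¬ UniformDeductiveInterpolation (flVariety.{u} E) ∧
          ¬ HasModelCompletion.{u} (theoryOf (flVariety.{u} E)) := fun E hE => by
      have hFL : flVariety.{u} E ⊆ flVariety ∅ := fun A hA => ⟨hA.1, by simp⟩
      have hV := isVariety_flVariety.{u} E
      have hfix := fixpointExtension_flVariety.{u} hE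
      have hpot := not_satisfies_potencyEqn.{u} hE
      exact ⟨not_coherent hFL hV hfix hpot, not_uniformDeductiveInterpolation hFL hV hfix hpot,
        not_hasModelCompletion hFL hV hfix hpot⟩
    intro E hE V hV
    have hE' : E ⊆ exchangeAx ∪ weakeningAx := by
      rcases hE with rfl | rfl | rfl | rfl <;> simp
    rcases hV with rfl | rfl
    · exact key _ (hE'.trans Set.subset_union_left)
    · exact key _ (Set.union_subset_union_left _ hE')
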